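/- Let $J$ be a real open interval, $t_0\in J$, $\theta_0\in\mathbb R$, let $\mu$ be a measure on $[\theta_0,\theta_0+2\pi)$, and let $$\mathrm d\mu(\theta;t)=\omega(\theta;t)\,\mathrm d\mu(\theta)+\sum_{j=0}^N\gamma_j(t)\,\delta(\theta-\omega_j(t)),\qquad t\in J,$$ be finite nonnegative measures ($\omega\ge 0$, $\gamma_j\ge0$) with infinite support on the unit circle $\mathbb S^1$, parametrized by $z=e^{i\theta}$. Suppose that the real functions $\gamma_j,\omega_j$ are differentiable on $J$ and that, for $\mu$-almost all $\theta\in[\theta_0,\theta_0+2\pi)$, $\omega(\theta;\cdot)$ is finite and differentiable on $J$ with $|\frac{\partial\omega}{\partial t}(\theta;t)|\le\alpha(\theta)$ for all $t\in J$, where $\alpha$ is $\mu$-integrable. For $t\in J$ let $Q_n(\cdot;t)$ be the monic orthogonal polynomials of $\mathrm d\mu(\theta;t)$ on the unit circle, $Q_n^*(z;t)=z^n\overline{Q_n(1/\overline z;t)}$, let $b(t)\in\mathbb S^1$, let $n\ge0$ be fixed, and let $$P(z;t)=zQ_n(z;t)-\overline{b(t)}\,Q_n^*(z;t)$$ be the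 corresponding monic paraorthogonal polynomial (POPUC) of degree $n+1$. Let $P(\zeta_0;t_0)=0$. Write $I_\epsilon=(t_0-\epsilon,t_0+\epsilon)$ and $C_\delta=\{z\in\mathbb S^1:|z-\zeta_0|<\delta\}$. (1) Suppose that $b$ is differentiable on $J$, or that $P(e^{i\theta_0};t)=0$ for all $t\in J$. Then there are $\epsilon,\delta>0$ with $I_\epsilon\subseteq J$ and a unique differentiable function $\zeta:I_\epsilon\to C_\delta$ with $\zeta(t_0)=\zeta_0$ and $P(\zeta(t);t)=0$ for all $t\in I_\epsilon$. (2) Let $\epsilon,\delta>0$ with $I_\epsilon\subseteq J$ and let $\zeta:I_\epsilon\to C_\delta$ be a differentiable function with $\zeta(t_0)=\zeta_0$ and $P(\zeta(t);t)=0$ for all $t\in I_\epsilon$. Assume that $P(e^{i\theta_0};t)=0$ for all $t\in I_\epsilon$, that $\zeta_0\ne e^{i\theta_0}$, and that $P(e^{i\omega_j(t)};t)\neq0$ for all $j$ and all $t\in I_\epsilon$. Write $\zeta(t)=e^{i\varphi(t)}$ with $\varphi(t)\in[\theta_0,\theta_0+2\pi)$, let $e^{i\varphi_k(t)}$ ($k=1,\dots,n+1$)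 be the zeros of $P(\cdot;t)$, with $\varphi_{n}(t)=\theta_0$ and $\varphi_{n+1}(t)=\varphi(t)$, and put $$s(\theta;t)=\frac{\sin\frac{\varphi(t)-\theta_0}2}{2\sin\frac{\varphi(t)-\theta}2\,\sin\frac{\theta_0-\theta}2},\qquad S(\theta;t)=\sum_{k=1}^{n-1}\cot\frac{\varphi_k(t)-\theta}2+\frac12\cot\frac{\theta_0-\theta}2+\frac12\cot\frac{\varphi(t)-\theta}2,$$ $$f(\theta;t)=\frac1{\omega(\theta;t)}\frac{\partial\omega}{\partial t}(\theta;t),\qquad W(\theta;t)=s(\theta;t)\bigl(f(\theta;t)-f(\varphi(t);t)\bigr),$$ $$W_j(t)=s(\omega_j(t);t)\,\gamma_j'(t)-\gamma_j(t)\,s(\omega_j(t);t)\,S(\omega_j(t);t)\,\omega_j'(t)-\gamma_j(t)\,s(\omega_j(t);t)\,f(\varphi(t);t),$$ where $f(\theta;t)$ is read as $0$ at any $\theta$ at which $\omega(\theta;t)=0$ or the partial derivative does not exist. (2a) If for every $t\in I_\epsilon$ the function $f(\cdot;t)$ is nondecreasing on $(\theta_0,\theta_0+2\pi)$ and $W_j(t)\ge0$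 for all $j$, and if for every $t\in I_\epsilon$ moreover $f(\cdot;t)$ is strictly increasing on $(\theta_0,\theta_0+2\pi)$ or $W_j(t)>0$ for some $j$, then $\zeta$ moves strictly counterclockwise on $I_\epsilon$: $\varphi$ is continuous and strictly increasing on $I_\epsilon$. (2b) If for every $t\in I_\epsilon$ one has $W(\theta;t)=0$ for $\mu$-almost every $\theta\in[\theta_0,\theta_0+2\pi)$ and $W_j(t)=0$ for all $j$, then $\zeta$ does not move: $\zeta(t)=\zeta_0$ for all $t\in I_\epsilon$. -/

import Mathlib

open MeasureTheory Set Polynomial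

noncomputable section

namespace POPUC

/-- The point of the unit circle with angle `θ`. -/
def pt (θ : ℝ) : ℂ := Complex.exp (θ * Complex.I)

/-- The measure `ω(θ;t) dμ(θ) + ∑ j, γ_j(t) δ(θ - ω_j(t))` on the unit circle, as a measure in the
angle `θ`; the absolutely continuous part (with respect to `μ`) lives on `[θ₀, θ₀ + 2π)`. A point
mass may be given by any angle representing its location on the circle. -/
def mixedMeasure (θ₀ : ℝ) (μ : Measure ℝ) (ω : ℝ → ℝ → ℝ) {N : ℕ} (γ Ω : Fin (N + 1) → ℝ → ℝ)
    (t : ℝ) : Measure ℝ :=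
  (μ.restrict (Ico θ₀ (θ₀ + 2 * Real.pi))).withDensity (fun θ => ENNReal.ofReal (ω θ t))
    + ∑ j, ENNReal.ofReal (γ j t) • Measure.dirac (Ω j t)

/-- A measure in the angle that, seen on the circle, is not carried by finitely many points. -/
def HasInfiniteSupport (m : Measure ℝ) : Prop :=
  ∀ F : Set ℂ, F.Finite → m {θ | pt θ ∉ F} ≠ 0

/-- `Q` is the sequence of monic orthogonal polynomials on the unit circle of `m`. -/
structure IsOPUC (m : Measure ℝ) (Q : ℕ → ℂ[X]) : Prop where
  monic : ∀ n, (Q n).Monic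
  natDegree : ∀ n, (Q n).natDegree = n
  orthogonal : ∀ n k, n ≠ k →
    ∫ θ, (Q n).eval (pt θ) * (starRingEnd ℂ) ((Q k).eval (pt θ)) ∂m = 0
  norm_ne_zero : ∀ n, ∫ θ, ‖(Q n).eval (pt θ)‖ ^ 2 ∂m ≠ 0

/-- The polynomial `z ^ n * conj (q (1 / conj z))`, for `q` of degree at most `n`. -/
def revStar (n : ℕ) (q : ℂ[X]) : ℂ[X] := (q.map (starRingEnd ℂ)).reflect n

theorem eval_revStar (n : ℕ) (q : ℂ[X]) (hq : q.natDegree ≤ n) (z : ℂ) (hz : z ≠ 0) :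
    (revStar n q).eval z
      = z ^ n * (starRingEnd ℂ) (q.eval (1 / (starRingEnd ℂ) z)) := by
  have hz' : z⁻¹ ≠ 0 := inv_ne_zero hz
  let _ : Invertible z⁻¹ := invertibleOfNonzero hz'
  have h := eval₂_reflect_mul_pow (RingHom.id ℂ) z⁻¹ n (q.map (starRingEnd ℂ))
    (by rw [natDegree_map]; exact hq)
  have h2 : (starRingEnd ℂ) (q.eval (1 / (starRingEnd ℂ) z))
      = (q.map (starRingEnd ℂ)).eval z⁻¹ := by
    have h3 := eval_map_apply (p := q) (starRingEnd ℂ) (1 / (starRingEnd ℂ) z)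
    rw [← h3]; simp
  rw [h2]
  simp only [invOf_eq_inv, inv_inv, eval₂_id] at h
  rw [← h, revStar, mul_comm, mul_assoc, ← mul_pow, inv_mul_cancel₀ hz, one_pow, mul_one]

/-- `P` is the monic paraorthogonal polynomial of degree `n + 1` of `m` with paraorthogonality
parameter `b` on the unit circle: `P(z) = z Q_n(z) - conj b * Q_n^*(z)`. -/
def IsPOPUC (m : Measure ℝ) (n : ℕ) (b : ℂ) (P : ℂ[X]) : Prop :=
  ‖b‖ = 1 ∧ ∃ Q : ℕ → ℂ[X], IsOPUC m Q ∧
    P = X * Q n - C ((starRingEnd ℂ) b) * revStar n (Q n)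

/-- `I_ε(t₀)`. -/
def nbhd (t₀ ε : ℝ) : Set ℝ := Ioo (t₀ - ε) (t₀ + ε)

/-- `ζ`, restricted to `I_ε(t₀)`, is a differentiable function from `I_ε(t₀)` to the arc
`{z : |z| = 1, |z - ζ₀| < δ}` with `ζ(t₀) = ζ₀` and `P(ζ(t);t) = 0` for each `t`. -/
structure IsZeroBranch (P : ℝ → ℂ[X]) (t₀ : ℝ) (ζ₀ : ℂ) (ε δ : ℝ) (ζ : ℝ → ℂ) : Prop where
  mem_arc : ∀ t ∈ nbhd t₀ ε, ‖ζ t‖ = 1 ∧ ζ t ∈ Metric.ball ζ₀ δ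
  differentiable : DifferentiableOn ℝ ζ (nbhd t₀ ε)
  initial : ζ t₀ = ζ₀
  zero : ∀ t ∈ nbhd t₀ ε, (P t).eval (ζ t) = 0

/-- `s(θ)` for the fixed zero of angle `θ₀` and the moving zero of angle `φ`. -/
def s (θ₀ φ θ : ℝ) : ℝ :=
  Real.sin ((φ - θ₀) / 2) / (2 * Real.sin ((φ - θ) / 2) * Real.sin ((θ₀ - θ) / 2))

open Classical in
/-- `S(θ)`: the sum over the zeros `z = e^{iφ_k}` of `P` of `cot ((φ_k - θ) / 2)`, where the zeros
`e^{iθ₀}` and `e^{iφ}` have weight `1 / 2` and the others have weight `1`. As `cot` has period `π`,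
the choice of the angle `φ_k` of a zero does not matter. -/
def S (P : ℂ[X]) (θ₀ φ θ : ℝ) : ℝ :=
  (P.roots.map (fun z => (if z = pt θ₀ ∨ z = pt φ then 1 / 2 else 1)
    * Real.cot ((Complex.arg z - θ) / 2))).sum

/-- `f(θ;t) = (1 / ω(θ;t)) ∂ω/∂t(θ;t)`, with value `0` at the exceptional `θ` where `ω(θ;t) = 0` or the
partial derivative does not exist. -/
def f (ω : ℝ → ℝ → ℝ) (θ t : ℝ) : ℝ := 1 / ω θ t * deriv (fun τ => ω θ τ) t

/-- `W(θ;t)`; here `φ` is the angle of the moving zero at time `t`. -/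
def W (θ₀ : ℝ) (ω : ℝ → ℝ → ℝ) (φ θ t : ℝ) : ℝ := s θ₀ φ θ * (f ω θ t - f ω φ t)

/-- `W_j(t)` for the point mass `γ` at the angle `Ω`; here `φ` is the angle of the moving zero of
`P` at time `t`. -/
def Wj (θ₀ : ℝ) (ω : ℝ → ℝ → ℝ) (γ Ω : ℝ → ℝ) (P : ℂ[X]) (φ t : ℝ) : ℝ :=
  s θ₀ φ (Ω t) * deriv γ t
    - γ t * s θ₀ φ (Ω t) * S P θ₀ φ (Ω t) * deriv Ω t
    - γ t * s θ₀ φ (Ω t) * f ω φ t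

end POPUC

end

noncomputable section

namespace POPUC

open scoped ComplexConjugate

/-! Paraorthogonality says that `P` is orthogonal to `X * T` whenever `T` has degree below `n`. If
`P = (X - z₀)(X - w) R` with `w` the reflection of `z₀` in the circle, then pairing `P` with `X * R`
gives `-w ‖(X - z₀) R‖²`, which is nonzero by infinite support. Since the zeros are invariant under
reflection, they all lie on the circle and are simple (`IsPOPUC.not_dvd`).

The coefficients of the orthogonal polynomials solve a Gram system with differentiable entries.
Those of `P` are therefore differentiable once `b` is, and a fixed zero on the circle determines `b`
from `Q_n`. Divided differences then give a unique differentiable branch through each simple zero,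
without continuity of the derivative in `t`.

For the velocity, write `P = (X - ζ)(X - w) R` at one time, with `w` the fixed zero, and
differentiate the pairing of `P` with the frozen polynomial `X * R`. The time derivative of `P` plus
`ζ' (X - w) R` vanishes at both `ζ` and `w`, and `ip_swap` turns its pairing into another instance
of paraorthogonality. What remains expresses `ζ'` through the derivative of the measure alone
(`IsDifferentiableFamily.derivIntegral_eq`).

On the circle the integrand `P conj(X R)` is a constant times a real kernel `G = weight * s` with
logarithmic derivative `-S`. As `G` has integral zero, `f(φ)` times that integral can be subtracted,
which produces `W` and `W_j`. Hence `ζ' = i ζ κ V` with `κ > 0` and `V` a nonnegatively weighted sum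
of `W` and `W_j` (`IsDifferentiableFamily.hasDerivAt_branch`). For monotone `f`, the factors `s` and
`f(θ) - f(φ)` change sign together at `φ`, so `V ≥ 0`; strictness comes from infinite support or
from a positive `W_j`. -/

theorem norm_pt (θ : ℝ) : ‖pt θ‖ = 1 := by
  simp [pt, Complex.norm_exp_ofReal_mul_I]

theorem pt_ne_zero (θ : ℝ) : pt θ ≠ 0 := Complex.exp_ne_zero _

theorem mul_conj_of_norm_eq_one {z : ℂ} (hz : ‖z‖ = 1) : z * conj z = 1 := by
  rw [Complex.mul_conj, Complex.normSq_eq_norm_sq, hz]; simp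

theorem conj_eq_inv_of_norm_eq_one {z : ℂ} (hz : ‖z‖ = 1) : conj z = z⁻¹ :=
  eq_inv_of_mul_eq_one_right (mul_conj_of_norm_eq_one hz)

theorem pt_mul_conj (θ : ℝ) : pt θ * conj (pt θ) = 1 := mul_conj_of_norm_eq_one (norm_pt θ)

@[fun_prop]
theorem continuous_pt : Continuous pt := by unfold pt; fun_prop

theorem pt_add (a b : ℝ) : pt (a + b) = pt a * pt b := by
  simp [pt, add_mul, Complex.exp_add]

theorem hasDerivAt_pt (θ : ℝ) : HasDerivAt pt (Complex.I * pt θ) θ := by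
  have h : HasDerivAt (fun x : ℝ => (x : ℂ) * Complex.I) Complex.I θ := by
    simpa using (Complex.ofRealCLM.hasDerivAt (x := θ)).mul_const Complex.I
  rw [mul_comm]
  exact h.cexp

theorem exists_pt_eq {z : ℂ} (hz : ‖z‖ = 1) : pt (Complex.arg z) = z := by
  have := Complex.norm_mul_exp_arg_mul_I z
  rw [hz] at this
  simpa [pt] using this

/-- A continuous function of the point on the circle is bounded. -/
theorem bounded_comp_pt {g : ℂ → ℂ} (hg : Continuous g) : ∃ C, ∀ θ, ‖g (pt θ)‖ ≤ C := by
  obtain ⟨C, hC⟩ := (isCompact_sphere (0 : ℂ) 1).exists_bound_of_continuousOn hg.continuousOn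
  exact ⟨C, fun θ => hC _ (by simp [norm_pt])⟩

/-- The sesquilinear form of a measure on the circle. -/
def ip (m : Measure ℝ) (p q : ℂ[X]) : ℂ := ∫ θ, p.eval (pt θ) * conj (q.eval (pt θ)) ∂m

theorem continuous_ip_integrand (p q : ℂ[X]) :
    Continuous fun z : ℂ => p.eval z * conj (q.eval z) := by
  have := Complex.continuous_conj
  fun_prop

theorem integrable_ip (m : Measure ℝ) [IsFiniteMeasure m] (p q : ℂ[X]) :
    Integrable (fun θ => p.eval (pt θ) * conj (q.eval (pt θ))) m := by
  obtain ⟨C, hC⟩ := bounded_comp_pt (continuous_ip_integrand p q)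
  exact Integrable.of_bound
    ((continuous_ip_integrand p q).comp continuous_pt).aestronglyMeasurable C
    (Filter.Eventually.of_forall hC)

/-! ### The sesquilinear form of a measure on polynomials -/

section ip

variable (m : Measure ℝ)

theorem ip_conj (p q : ℂ[X]) : conj (ip m p q) = ip m q p := by
  rw [ip, ← integral_conj, ip]
  congr 1; ext θ; simp [mul_comm]

theorem ip_C_mul_left (c : ℂ) (p q : ℂ[X]) : ip m (C c * p) q = c * ip m p q := by
  rw [ip, ip, ← integral_const_mul]
  congr 1; ext θ; simp [mul_assoc]

theorem ip_C_mul_right (c : ℂ) (p q : ℂ[X]) : ip m p (C c * q) = conj c * ip m p q := by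
  rw [← ip_conj, ip_C_mul_left, map_mul, ip_conj]

theorem ip_zero_left (q : ℂ[X]) : ip m 0 q = 0 := by simp [ip]

theorem ip_zero_right (q : ℂ[X]) : ip m q 0 = 0 := by simp [ip]

theorem ip_X_mul (p q : ℂ[X]) : ip m (X * p) (X * q) = ip m p q := by
  rw [ip, ip]
  congr 1; ext θ
  simp only [eval_mul, eval_X, map_mul]
  linear_combination (eval (pt θ) p * conj (eval (pt θ) q)) * pt_mul_conj θ

theorem ip_self (p : ℂ[X]) : ip m p p = ((∫ θ, ‖p.eval (pt θ)‖ ^ 2 ∂m : ℝ) : ℂ) := by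
  rw [ip, ← integral_complex_ofReal]
  congr 1; ext θ
  rw [Complex.mul_conj, Complex.normSq_eq_norm_sq]

variable [IsFiniteMeasure m]

theorem ip_add_left (p q r : ℂ[X]) : ip m (p + q) r = ip m p r + ip m q r := by
  rw [ip, ip, ip, ← integral_add (integrable_ip m p r) (integrable_ip m q r)]
  congr 1; ext θ; simp [add_mul]

theorem ip_add_right (p q r : ℂ[X]) : ip m r (p + q) = ip m r p + ip m r q := by
  rw [← ip_conj, ip_add_left, map_add, ip_conj, ip_conj]

theorem ip_sub_left (p q r : ℂ[X]) : ip m (p - q) r = ip m p r - ip m q r := by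
  have := ip_add_left m (p - q) q r
  rw [sub_add_cancel] at this
  exact eq_sub_of_add_eq this.symm

theorem ip_sum_left {ι : Type*} (s : Finset ι) (p : ι → ℂ[X]) (q : ℂ[X]) :
    ip m (∑ i ∈ s, p i) q = ∑ i ∈ s, ip m (p i) q := by
  classical
  induction s using Finset.induction_on with
  | empty => simp [ip_zero_left]
  | insert a s ha ih => rw [Finset.sum_insert ha, Finset.sum_insert ha, ip_add_left, ih]

theorem ip_sum_right {ι : Type*} (s : Finset ι) (p : ι → ℂ[X]) (q : ℂ[X]) :
    ip m q (∑ i ∈ s, p i) = ∑ i ∈ s, ip m q (p i) := by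
  rw [← ip_conj, ip_sum_left, map_sum]
  simp_rw [ip_conj]

/-- The factor `r` is `X` for paraorthogonality and `1` for the Gram matrix. -/
theorem ip_mul_eq_zero_of_monomials {n : ℕ} {p r : ℂ[X]} (h : ∀ k < n, ip m p (r * X ^ k) = 0)
    {q : ℂ[X]} (hq : q.degree < n) : ip m p (r * q) = 0 := by
  by_cases hq0 : q = 0
  · rw [hq0, mul_zero, ip_zero_right]
  rw [q.as_sum_range_C_mul_X_pow' ((natDegree_lt_iff_degree_lt hq0).2 hq), Finset.mul_sum,
    ip_sum_right]
  refine Finset.sum_eq_zero fun i hi => ?_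
  rw [mul_left_comm, ip_C_mul_right, h i (Finset.mem_range.1 hi), mul_zero]

variable {m}

/-- The integrand vanishes only at the finitely many roots of `p`, which cannot carry the measure.
-/
theorem integral_norm_sq_pos (hm : HasInfiniteSupport m) {p : ℂ[X]} (hp : p ≠ 0) :
    0 < ∫ θ, ‖p.eval (pt θ)‖ ^ 2 ∂m := by
  rw [integral_pos_iff_support_of_nonneg (fun θ => by positivity)]
  · refine pos_iff_ne_zero.2 fun h => hm (p.roots.toFinset : Set ℂ) (Finset.finite_toSet _) ?_
    refine measure_mono_null (fun θ hθ => ?_) h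
    simpa [hp] using hθ
  · have := (integrable_ip m p p).norm
    refine this.congr (Filter.Eventually.of_forall fun θ => ?_)
    simp [sq]

theorem ip_self_ne_zero (hm : HasInfiniteSupport m) {p : ℂ[X]} (hp : p ≠ 0) : ip m p p ≠ 0 := by
  rw [ip_self]
  exact_mod_cast (integral_norm_sq_pos hm hp).ne'

end ip

/-! ### Orthogonal and paraorthogonal polynomials and their zeros -/

section OPUC

variable {m : Measure ℝ} {Q : ℕ → ℂ[X]}

theorem IsOPUC.degree_eq (hQ : IsOPUC m Q) (n : ℕ) : (Q n).degree = n := by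
  rw [degree_eq_natDegree (hQ.monic n).ne_zero, hQ.natDegree n]

/-- Being monic of each degree, `Q 0, …, Q (n - 1)` span the polynomials of degree less than `n`. -/
theorem IsOPUC.ip_eq_zero [IsFiniteMeasure m] (hQ : IsOPUC m Q) {n : ℕ} {q : ℂ[X]}
    (hq : q.degree < n) :
    ip m (Q n) q = 0 := by
  let T : Polynomial.Sequence ℂ := ⟨Q, hQ.degree_eq⟩
  have hs := T.span_degreeLT (m := n) fun i _ => by
    change IsUnit (Q i).leadingCoeff
    rw [(hQ.monic i).leadingCoeff]; exact isUnit_one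
  have hq' : q ∈ Submodule.span ℂ (T '' Iio n) := hs ▸ mem_degreeLT.2 hq
  induction hq' using Submodule.span_induction with
  | mem x hx =>
    obtain ⟨k, hk, rfl⟩ := hx
    exact hQ.orthogonal n k (ne_of_gt hk)
  | zero => exact ip_zero_right m _
  | add x y hx hy h1 h2 =>
    rw [hs, mem_degreeLT] at hx hy
    rw [ip_add_right, h1 hx, h2 hy, add_zero]
  | smul a x hx h =>
    rw [hs, mem_degreeLT] at hx
    rw [smul_eq_C_mul, ip_C_mul_right, h hx, mul_zero]

/-- The zeros of an orthogonal polynomial do not lie on the circle. -/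
theorem IsOPUC.eval_ne_zero [IsFiniteMeasure m] (hm : HasInfiniteSupport m) (hQ : IsOPUC m Q)
    (n : ℕ) {z : ℂ} (hz : ‖z‖ = 1) : (Q n).eval z ≠ 0 := by
  intro h
  obtain ⟨K, hK⟩ := dvd_iff_isRoot.2 h
  have hK0 : K ≠ 0 := fun h0 => (hQ.monic n).ne_zero (by rw [hK, h0, mul_zero])
  have hdeg : K.degree < n := by
    rw [← hQ.degree_eq n, hK, degree_mul, degree_X_sub_C, degree_eq_natDegree hK0]
    exact_mod_cast (by omega : K.natDegree < 1 + K.natDegree)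
  have h1 : ip m (Q n) K = 0 := hQ.ip_eq_zero hdeg
  have h2 : ip m K (Q n) = 0 := by rw [← ip_conj, h1, map_zero]
  -- Multiplication by `X` is isometric and `Q n` is orthogonal to `K`, so Pythagoras gives `‖K‖² =
  -- ‖Q n‖² + ‖K‖²`.
  have h3 : X * K = Q n + C z * K := by rw [hK]; ring
  have h4 := ip_X_mul m K K
  rw [h3, ip_add_left, ip_add_right, ip_add_right, ip_C_mul_left, ip_C_mul_left, ip_C_mul_right,
    ip_C_mul_right, h1, h2] at h4
  refine ip_self_ne_zero hm (hQ.monic n).ne_zero ?_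
  linear_combination h4 - ip m K K * mul_conj_of_norm_eq_one hz

theorem eval_revStar_of_norm_eq_one {n : ℕ} {q : ℂ[X]} (hq : q.natDegree ≤ n) {z : ℂ}
    (hz : ‖z‖ = 1) : (revStar n q).eval z = z ^ n * conj (q.eval z) := by
  have hz0 : z ≠ 0 := by rintro rfl; simp at hz
  rw [eval_revStar n q hq z hz0, conj_eq_inv_of_norm_eq_one hz]
  simp

theorem natDegree_revStar_le {n : ℕ} {q : ℂ[X]} (hq : q.natDegree ≤ n) :
    (revStar n q).natDegree ≤ n := by
  refine natDegree_reflect_le.trans (max_le le_rfl ?_)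
  rwa [natDegree_map]

theorem coeff_revStar {n : ℕ} (q : ℂ[X]) {i : ℕ} (hi : i ≤ n) :
    (revStar n q).coeff i = conj (q.coeff (n - i)) := by
  rw [revStar, coeff_reflect, revAt_le hi, coeff_map]

variable {n : ℕ} {b : ℂ} {P : ℂ[X]}

theorem IsOPUC.degree_revStar_lt (hQ : IsOPUC m Q) (n : ℕ) (c : ℂ) :
    (C c * revStar n (Q n)).degree < (X * Q n).degree := by
  rw [degree_mul (p := X), degree_X, hQ.degree_eq]
  refine (degree_le_of_natDegree_le ((natDegree_C_mul_le _ _).trans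
    (natDegree_revStar_le (hQ.natDegree n).le))).trans_lt ?_
  exact_mod_cast (by omega : n < 1 + n)

theorem IsPOPUC.monic (hP : IsPOPUC m n b P) : P.Monic := by
  obtain ⟨-, Q, hQ, rfl⟩ := hP
  exact (monic_X.mul (hQ.monic n)).sub_of_left (hQ.degree_revStar_lt n _)

theorem IsPOPUC.natDegree (hP : IsPOPUC m n b P) : P.natDegree = n + 1 := by
  obtain ⟨-, Q, hQ, rfl⟩ := hP
  rw [natDegree_eq_of_degree_eq (degree_sub_eq_left_of_degree_lt (hQ.degree_revStar_lt n _)),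
    natDegree_X_mul (hQ.monic n).ne_zero, hQ.natDegree n]

/-- Paraorthogonality. -/
theorem IsPOPUC.ip_eq_zero [IsFiniteMeasure m] (hP : IsPOPUC m n b P) {T : ℂ[X]}
    (hT : T.degree < n) : ip m P (X * T) = 0 := by
  obtain ⟨-, Q, hQ, rfl⟩ := hP
  rw [ip_sub_left, ip_X_mul, hQ.ip_eq_zero hT, ip_C_mul_left]
  have : ip m (revStar n (Q n)) (X * T) = 0 := by
    have : ∀ k < n, ip m (revStar n (Q n)) (X * X ^ k) = 0 := by
      intro k hk
      -- On the circle the reversed polynomial is `z ^ n * conj (Q n)`, so its pairing with `z ^ (k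
      -- + 1)` is that of `z ^ (n - k - 1)` with `Q n`.
      have h1 : ip m (X ^ (n - (k + 1))) (Q n) = 0 := by
        rw [← ip_conj, hQ.ip_eq_zero, map_zero]
        rw [degree_X_pow]
        exact_mod_cast (by omega : n - (k + 1) < n)
      rw [← h1, ip, ip]
      congr 1; ext θ
      rw [eval_revStar_of_norm_eq_one (hQ.natDegree n).le (norm_pt θ)]
      have h2 : pt θ ^ n = pt θ ^ (n - (k + 1)) * pt θ ^ (k + 1) := by
        rw [← pow_add]; congr 1; omega
      have h3 : pt θ ^ (k + 1) * conj (pt θ) ^ (k + 1) = 1 := by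
        rw [← mul_pow, pt_mul_conj, one_pow]
      rw [h2]
      simp only [eval_mul, eval_X, eval_pow, map_mul, map_pow]
      linear_combination (pt θ ^ (n - (k + 1)) * conj (eval (pt θ) (Q n))) * h3
    exact ip_mul_eq_zero_of_monomials m this hT
  rw [this]; simp

/-- The value of `ip m P (X * R)` for `P = (X - z₀) (X - w) R`, where `z₀`, `w` are symmetric
with respect to the circle. -/
theorem ip_symmetric_factor {z₀ w : ℂ} (hw : w * conj z₀ = 1) (R : ℂ[X]) :
    ip m ((X - C z₀) * (X - C w) * R) (X * R)
      = -w * ip m ((X - C z₀) * R) ((X - C z₀) * R) := by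
  rw [ip, ip, ← integral_const_mul]
  congr 1; ext θ
  simp only [eval_mul, eval_sub, eval_X, eval_C, map_mul, map_sub]
  linear_combination (pt θ - z₀) * eval (pt θ) R * conj (eval (pt θ) R) * (pt_mul_conj θ - hw)

/-- Otherwise paraorthogonality against `X * R`, for the quotient `R`, would make the norm of `(X -
z₀) R` vanish. The case `w = z₀` excludes double zeros on the circle, the case `w ≠ z₀` zeros off
it. -/
theorem IsPOPUC.not_dvd [IsFiniteMeasure m] (hm : HasInfiniteSupport m)
    (hP : IsPOPUC m n b P) {z₀ w : ℂ} (hw : w * conj z₀ = 1) : ¬ (X - C z₀) * (X - C w) ∣ P := by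
  rintro ⟨R, hR⟩
  have hP0 : P ≠ 0 := hP.monic.ne_zero
  have hR0 : R ≠ 0 := fun h => hP0 (by rw [hR, h, mul_zero])
  have hdeg : R.degree < n := by
    have h1 := hP.natDegree
    rw [hR, natDegree_mul (mul_ne_zero (X_sub_C_ne_zero _) (X_sub_C_ne_zero _)) hR0,
      natDegree_mul (X_sub_C_ne_zero _) (X_sub_C_ne_zero _), natDegree_X_sub_C,
      natDegree_X_sub_C] at h1
    rw [degree_eq_natDegree hR0]
    exact_mod_cast (by omega : R.natDegree < n)
  have h := hP.ip_eq_zero hdeg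
  rw [hR, ip_symmetric_factor hw] at h
  have hw0 : w ≠ 0 := by rintro rfl; simp at hw
  exact mul_ne_zero (neg_ne_zero.2 hw0)
    (ip_self_ne_zero hm (mul_ne_zero (X_sub_C_ne_zero _) hR0)) h

/-- The constant term of `P` is `-conj b`, because `Q n` is monic. -/
theorem IsPOPUC.ne_zero_of_eval_eq_zero (hP : IsPOPUC m n b P) {z : ℂ} (hz : P.eval z = 0) :
    z ≠ 0 := by
  obtain ⟨hb, Q, hQ, rfl⟩ := hP
  rintro rfl
  rw [← coeff_zero_eq_eval_zero, coeff_sub, coeff_C_mul, coeff_revStar _ (Nat.zero_le n),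
    Nat.sub_zero] at hz
  have h1 : (Q n).coeff n = 1 := by
    have := hQ.monic n
    rwa [Monic, leadingCoeff, hQ.natDegree n] at this
  rw [h1] at hz
  simp at hz
  simp [hz] at hb

/-- As `|b| = 1`, conjugating the equation at `z` gives the equation at the reflected point up to a
nonzero factor. -/
theorem IsPOPUC.eval_conj_inv (hP : IsPOPUC m n b P) {z : ℂ} (hz : P.eval z = 0) :
    P.eval (1 / conj z) = 0 := by
  have hz0 := hP.ne_zero_of_eval_eq_zero hz
  obtain ⟨hb, Q, hQ, rfl⟩ := hP
  have hc0 : conj z ≠ 0 := (_root_.map_ne_zero _).2 hz0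
  have hbb := mul_conj_of_norm_eq_one hb
  simp only [eval_sub, eval_mul, eval_X, eval_C] at hz ⊢
  rw [eval_revStar _ _ (hQ.natDegree n).le _ hz0] at hz
  rw [eval_revStar _ _ (hQ.natDegree n).le _ (by simpa using hz0)]
  have h1 : (1 / conj (1 / conj z)) = z := by simp
  rw [h1]
  have h2 := congrArg conj hz
  simp only [map_sub, map_mul, map_pow, Complex.conj_conj, map_zero] at h2
  have h3 : conj (eval z (Q n)) = b * conj z ^ n * eval (1 / conj z) (Q n) / conj z := by
    field_simp; linear_combination h2
  rw [h3]
  have h4 : (1 / conj z) ^ n * conj z ^ n = 1 := by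
    rw [← mul_pow, one_div_mul_cancel hc0, one_pow]
  linear_combination (-(eval (1 / conj z) (Q n)) / conj z) * hbb
    - (conj b * b * eval (1 / conj z) (Q n) / conj z) * h4

theorem IsPOPUC.norm_eq_one [IsFiniteMeasure m] (hm : HasInfiniteSupport m)
    (hP : IsPOPUC m n b P) {z : ℂ} (hz : P.eval z = 0) : ‖z‖ = 1 := by
  by_contra hne
  have hz0 := hP.ne_zero_of_eval_eq_zero hz
  have hc0 : conj z ≠ 0 := (_root_.map_ne_zero _).2 hz0
  have hw := hP.eval_conj_inv hz
  refine hP.not_dvd hm (z₀ := z) (w := 1 / conj z) (by field_simp) ?_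
  refine IsCoprime.mul_dvd ?_ (dvd_iff_isRoot.2 hz) (dvd_iff_isRoot.2 hw)
  refine isCoprime_X_sub_C_of_isUnit_sub (sub_ne_zero.2 fun h => hne ?_).isUnit
  have h1 : z * conj z = 1 := by
    nth_rewrite 1 [h]; field_simp
  rw [Complex.mul_conj, Complex.normSq_eq_norm_sq] at h1
  have h2 : ‖z‖ ^ 2 = 1 := by exact_mod_cast h1
  exact (pow_eq_one_iff_of_nonneg (norm_nonneg z) two_ne_zero).1 h2

theorem IsPOPUC.derivative_ne_zero [IsFiniteMeasure m] (hm : HasInfiniteSupport m)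
    (hP : IsPOPUC m n b P) {z : ℂ} (hz : P.eval z = 0) : (derivative P).eval z ≠ 0 := by
  intro hd
  have h1 := (one_lt_rootMultiplicity_iff_isRoot hP.monic.ne_zero).2 ⟨hz, hd⟩
  have h2 : (X - C z) ^ 2 ∣ P := (le_rootMultiplicity_iff hP.monic.ne_zero).1 h1
  rw [sq] at h2
  exact hP.not_dvd hm (mul_conj_of_norm_eq_one (hP.norm_eq_one hm hz)) h2

end OPUC

open Filter Topology

/-! ### Linear systems and Gram matrices -/

section Gram

theorem differentiableAt_conj {f : ℝ → ℂ} {s : ℝ} (hf : DifferentiableAt ℝ f s) :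
    DifferentiableAt ℝ (fun t => conj (f t)) s :=
  (Complex.conjCLE.toContinuousLinearMap.differentiableAt (x := f s)).comp s hf

theorem differentiableAt_det {k : ℕ} {A : ℝ → Matrix (Fin k) (Fin k) ℂ} {s : ℝ}
    (hA : ∀ i j, DifferentiableAt ℝ (fun t => A t i j) s) :
    DifferentiableAt ℝ (fun t => (A t).det) s := by
  simp_rw [Matrix.det_apply']
  exact DifferentiableAt.fun_sum fun σ _ =>
    (DifferentiableAt.fun_finsetProd fun i _ => hA (σ i) i).const_mul _

/-- The solution of a regular linear system with differentiable data is differentiable. -/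
theorem differentiableAt_of_mulVec_eq {k : ℕ} {A : ℝ → Matrix (Fin k) (Fin k) ℂ}
    {x y : ℝ → Fin k → ℂ} {s : ℝ} (hA : ∀ i j, DifferentiableAt ℝ (fun t => A t i j) s)
    (hy : ∀ i, DifferentiableAt ℝ (fun t => y t i) s) (hdet : (A s).det ≠ 0)
    (h : ∀ᶠ t in 𝓝 s, (A t).mulVec (x t) = y t) (i : Fin k) :
    DifferentiableAt ℝ (fun t => x t i) s := by
  have hd := differentiableAt_det hA
  have hc : DifferentiableAt ℝ (fun t => ((A t).updateCol i (y t)).det) s := by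
    refine differentiableAt_det fun a b => ?_
    by_cases hb : b = i
    · subst hb; simpa using hy a
    · simpa [Matrix.updateCol_ne hb] using hA a b
  -- Cramer's rule: the `i`-th entry of the solution is a quotient of two differentiable
  -- determinants near `s`.
  refine (hc.div hd hdet).congr_of_eventuallyEq ?_
  filter_upwards [h, hd.continuousAt.eventually_ne hdet] with t ht hdt
  rw [Pi.div_apply, eq_div_iff hdt, ← Matrix.cramer_apply, ← ht, Matrix.cramer_eq_adjugate_mulVec,
    Matrix.mulVec_mulVec, Matrix.adjugate_mul, Matrix.smul_mulVec, Matrix.one_mulVec,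
    Pi.smul_apply, smul_eq_mul, mul_comm]

/-- The Gram matrix of the monomials of degree less than `n`. -/
def gram (m : Measure ℝ) (n : ℕ) : Matrix (Fin n) (Fin n) ℂ :=
  Matrix.of fun k i => ip m (X ^ (i : ℕ)) (X ^ (k : ℕ))

/-- A kernel vector is the coefficient vector of a polynomial of degree less than `n` orthogonal to
all such polynomials, hence to itself. -/
theorem det_gram_ne_zero {m : Measure ℝ} [IsFiniteMeasure m] (hm : HasInfiniteSupport m) (n : ℕ) :
    (gram m n).det ≠ 0 := by
  intro h
  obtain ⟨v, hv0, hv⟩ := Matrix.exists_mulVec_eq_zero_iff.2 h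
  let p : ℂ[X] := ∑ i : Fin n, C (v i) * X ^ (i : ℕ)
  have hcoeff : ∀ j : Fin n, p.coeff j = v j := by
    intro j
    simp only [p, finsetSum_coeff, coeff_C_mul, coeff_X_pow, mul_ite, mul_one, mul_zero]
    simp [Fin.val_inj]
  have hp : p ≠ 0 := by
    intro hp
    refine hv0 (funext fun j => ?_)
    rw [← hcoeff j, hp]; simp
  have hdeg : p.degree < n := by
    refine (degree_sum_fin_lt v)
  have horth : ∀ k < n, ip m p (1 * X ^ k) = 0 := by
    intro k hk
    have h1 := congrFun hv ⟨k, hk⟩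
    simp only [Matrix.mulVec, dotProduct, gram, Matrix.of_apply, Pi.zero_apply] at h1
    rw [one_mul, ip_sum_left, ← h1]
    exact Finset.sum_congr rfl fun i _ => by rw [ip_C_mul_left, mul_comm]
  have h2 := ip_mul_eq_zero_of_monomials m horth hdeg
  rw [one_mul] at h2
  exact ip_self_ne_zero hm hp h2

end Gram

/-! ### Differentiability of coefficients and of the parameter `b` -/

section Coefficients

variable {m : ℝ → Measure ℝ} {s : ℝ}

/-- Orthogonality to `X ^ k` for `k < n` is a linear system for the coefficients below the leading
one, with the Gram matrix on the left and `-⟨X ^ n, X ^ k⟩` on the right. -/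
theorem differentiableAt_coeff_OPUC (hfin : ∀ᶠ t in 𝓝 s, IsFiniteMeasure (m t))
    (hsupp : HasInfiniteSupport (m s)) (hip : ∀ p q, DifferentiableAt ℝ (fun t => ip (m t) p q) s)
    {Q : ℝ → ℕ → ℂ[X]} (hQ : ∀ᶠ t in 𝓝 s, IsOPUC (m t) (Q t)) (n i : ℕ) :
    DifferentiableAt ℝ (fun t => (Q t n).coeff i) s := by
  have := hfin.self_of_nhds
  rcases lt_trichotomy i n with hi | hi | hi
  · refine differentiableAt_of_mulVec_eq (A := fun t => gram (m t) n)
      (x := fun t i => (Q t n).coeff i) (y := fun t k => -ip (m t) (X ^ n) (X ^ (k : ℕ)))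
      (fun k i => hip _ _) (fun k => (hip _ _).fun_neg) (det_gram_ne_zero hsupp n) ?_ ⟨i, hi⟩
    filter_upwards [hfin, hQ] with t ht hQt
    have := ht
    ext k
    have h1 : ip (m t) (Q t n) (X ^ (k : ℕ)) = 0 :=
      hQt.ip_eq_zero (by rw [degree_X_pow]; exact_mod_cast k.2)
    have h2 : Q t n = X ^ n + ∑ i : Fin n, C ((Q t n).coeff i) * X ^ (i : ℕ) := by
      have h3 := (hQt.monic n).as_sum
      rwa [hQt.natDegree n, Finset.sum_range] at h3
    rw [h2, ip_add_left, ip_sum_left] at h1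
    rw [eq_neg_iff_add_eq_zero, add_comm, ← h1]
    simp only [Matrix.mulVec, dotProduct, gram, Matrix.of_apply]
    congr 1
    exact Finset.sum_congr rfl fun i _ => by rw [ip_C_mul_left, mul_comm]
  · subst hi
    refine (differentiableAt_const (1 : ℂ)).congr_of_eventuallyEq ?_
    filter_upwards [hQ] with t hQt
    have := hQt.monic i
    rwa [Monic, leadingCoeff, hQt.natDegree i] at this
  · refine (differentiableAt_const (0 : ℂ)).congr_of_eventuallyEq ?_
    filter_upwards [hQ] with t hQt
    exact coeff_eq_zero_of_natDegree_lt (by rw [hQt.natDegree n]; exact hi)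

theorem exists_family_OPUC {n : ℕ} {b : ℝ → ℂ} {P : ℝ → ℂ[X]}
    (hP : ∀ᶠ t in 𝓝 s, IsPOPUC (m t) n (b t) (P t)) :
    ∃ Q : ℝ → ℕ → ℂ[X], (∀ᶠ t in 𝓝 s, IsOPUC (m t) (Q t)) ∧
      ∀ᶠ t in 𝓝 s, P t = X * Q t n - C (conj (b t)) * revStar n (Q t n) := by
  classical
  refine ⟨fun t => if h : IsPOPUC (m t) n (b t) (P t) then h.2.choose else 0, ?_, ?_⟩
  · filter_upwards [hP] with t ht
    rw [dif_pos ht]; exact ht.2.choose_spec.1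
  · filter_upwards [hP] with t ht
    simp only [dif_pos ht]; exact ht.2.choose_spec.2

theorem differentiableAt_coeff_POPUC (hfin : ∀ᶠ t in 𝓝 s, IsFiniteMeasure (m t))
    (hsupp : HasInfiniteSupport (m s)) (hip : ∀ p q, DifferentiableAt ℝ (fun t => ip (m t) p q) s)
    {n : ℕ} {b : ℝ → ℂ} {P : ℝ → ℂ[X]} (hP : ∀ᶠ t in 𝓝 s, IsPOPUC (m t) n (b t) (P t))
    (hb : DifferentiableAt ℝ b s) (i : ℕ) : DifferentiableAt ℝ (fun t => (P t).coeff i) s := by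
  obtain ⟨Q, hQ, hPQ⟩ := exists_family_OPUC hP
  have hd := differentiableAt_coeff_OPUC hfin hsupp hip hQ n
  have h1 : DifferentiableAt ℝ (fun t => (X * Q t n).coeff i) s := by
    rcases i with _ | i
    · simp
    · simpa [coeff_X_mul] using hd i
  have h2 : DifferentiableAt ℝ (fun t => (revStar n (Q t n)).coeff i) s := by
    simp only [revStar, coeff_reflect, coeff_map]
    exact differentiableAt_conj (hd _)
  refine (h1.fun_sub ((differentiableAt_conj hb).fun_mul h2)).congr_of_eventuallyEq ?_
  filter_upwards [hPQ] with t ht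
  rw [ht, coeff_sub, coeff_C_mul]

/-- If a point of the circle is a zero of all the polynomials, then the paraorthogonality parameter
is differentiable. -/
theorem differentiableAt_parameter (hfin : ∀ᶠ t in 𝓝 s, IsFiniteMeasure (m t))
    (hsupp : HasInfiniteSupport (m s)) (hip : ∀ p q, DifferentiableAt ℝ (fun t => ip (m t) p q) s)
    {n : ℕ} {b : ℝ → ℂ} {P : ℝ → ℂ[X]} (hP : ∀ᶠ t in 𝓝 s, IsPOPUC (m t) n (b t) (P t))
    {z : ℂ} (hz : ‖z‖ = 1) (h0 : ∀ᶠ t in 𝓝 s, (P t).eval z = 0) : DifferentiableAt ℝ b s := by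
  obtain ⟨Q, hQ, hPQ⟩ := exists_family_OPUC hP
  have hd := differentiableAt_coeff_OPUC hfin hsupp hip hQ n
  have := hfin.self_of_nhds
  have hz0 : z ≠ 0 := by rintro rfl; simp at hz
  have hQz : DifferentiableAt ℝ (fun t => (Q t n).eval z) s := by
    have : DifferentiableAt ℝ (fun t => ∑ i ∈ Finset.range (n + 1), (Q t n).coeff i * z ^ i) s :=
      DifferentiableAt.fun_sum fun i _ => (hd i).mul_const _
    refine this.congr_of_eventuallyEq ?_
    filter_upwards [hQ] with t ht
    exact eval_eq_sum_range' (by rw [ht.natDegree n]; exact Nat.lt_succ_self n) z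
  -- `Q n` has no zero on the circle, so `P(z) = 0` can be solved for `conj b` as `z Q(z) / (z ^ n
  -- conj (Q(z)))`.
  have hne : (Q s n).eval z ≠ 0 := hQ.self_of_nhds.eval_ne_zero hsupp n hz
  have hne' : z ^ n * conj ((Q s n).eval z) ≠ 0 :=
    mul_ne_zero (pow_ne_zero _ hz0) ((_root_.map_ne_zero _).2 hne)
  have hden : DifferentiableAt ℝ (fun t => z ^ n * conj ((Q t n).eval z)) s :=
    (differentiableAt_conj hQz).const_mul _
  refine (differentiableAt_conj ((hQz.const_mul z).fun_div hden hne')).congr_of_eventuallyEq ?_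
  filter_upwards [hQ, hPQ, h0, hden.continuousAt.eventually_ne hne'] with t h1 h2 h3 h4
  rw [h2, eval_sub, eval_mul, eval_mul, eval_X, eval_C,
    eval_revStar_of_norm_eq_one (h1.natDegree n).le hz, sub_eq_zero] at h3
  rw [h3, mul_div_assoc, div_self h4, mul_one, Complex.conj_conj]

end Coefficients

/-- The measures `ω(θ;t) dμ(θ) + ∑ j, γ_j(t) δ(θ - ω_j(t))`, `t ∈ J`, are finite and nonnegative
with infinite support and depend differentiably on `t`. -/
structure IsDifferentiableFamily (J : Set ℝ) (θ₀ : ℝ) (μ : Measure ℝ) (ω : ℝ → ℝ → ℝ) {N : ℕ}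
    (γ Ω : Fin (N + 1) → ℝ → ℝ) : Prop where
  isOpen : IsOpen J
  integrable : ∀ t ∈ J, Integrable (fun θ => ω θ t) (μ.restrict (Ico θ₀ (θ₀ + 2 * Real.pi)))
  nonneg : ∀ᵐ θ ∂(μ.restrict (Ico θ₀ (θ₀ + 2 * Real.pi))), ∀ t ∈ J, 0 ≤ ω θ t
  mass_nonneg : ∀ j, ∀ t ∈ J, 0 ≤ γ j t
  support : ∀ t ∈ J, HasInfiniteSupport (mixedMeasure θ₀ μ ω γ Ω t)
  mass_differentiable : ∀ j, DifferentiableOn ℝ (γ j) J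
  angle_differentiable : ∀ j, DifferentiableOn ℝ (Ω j) J
  differentiable : ∀ᵐ θ ∂(μ.restrict (Ico θ₀ (θ₀ + 2 * Real.pi))), ∀ t ∈ J,
    DifferentiableAt ℝ (fun τ => ω θ τ) t
  exists_bound : ∃ α : ℝ → ℝ, Integrable α (μ.restrict (Ico θ₀ (θ₀ + 2 * Real.pi))) ∧
    ∀ᵐ θ ∂(μ.restrict (Ico θ₀ (θ₀ + 2 * Real.pi))), ∀ t ∈ J, |deriv (fun τ => ω θ τ) t| ≤ α θ

/-! ### Differentiating integrals against the moving measure -/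

namespace IsDifferentiableFamily

variable {J : Set ℝ} {θ₀ : ℝ} {μ : Measure ℝ} {ω : ℝ → ℝ → ℝ} {N : ℕ}
  {γ Ω : Fin (N + 1) → ℝ → ℝ} {t : ℝ}

theorem isFiniteMeasure (h : IsDifferentiableFamily J θ₀ μ ω γ Ω) (ht : t ∈ J) :
    IsFiniteMeasure (mixedMeasure θ₀ μ ω γ Ω t) := by
  have := isFiniteMeasure_withDensity_ofReal (h.integrable t ht).2
  have : IsFiniteMeasure (∑ j, ENNReal.ofReal (γ j t) • Measure.dirac (Ω j t)) := by
    refine ⟨?_⟩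
    simp [Measure.finsetSum_apply, ENNReal.sum_lt_top]
  unfold mixedMeasure
  infer_instance

variable {E : Type*} [NormedAddCommGroup E] [NormedSpace ℝ E] [CompleteSpace E] {g : ℝ → E}

theorem integral_eq (h : IsDifferentiableFamily J θ₀ μ ω γ Ω) (ht : t ∈ J) (hg : Continuous g)
    {K : ℝ} (hK : ∀ θ, ‖g θ‖ ≤ K) :
    ∫ θ, g θ ∂(mixedMeasure θ₀ μ ω γ Ω t)
      = ∫ θ in Ico θ₀ (θ₀ + 2 * Real.pi), ω θ t • g θ ∂μ + ∑ j, γ j t • g (Ω j t) := by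
  have := isFiniteMeasure_withDensity_ofReal (h.integrable t ht).2
  have hint : ∀ (m : Measure ℝ) [IsFiniteMeasure m], Integrable g m := fun m _ =>
    Integrable.of_bound hg.aestronglyMeasurable K (Eventually.of_forall hK)
  have hintj : ∀ j, Integrable g (ENNReal.ofReal (γ j t) • Measure.dirac (Ω j t)) := fun j =>
    (hint _).smul_measure ENNReal.ofReal_ne_top
  rw [mixedMeasure, integral_add_measure (hint _) (integrable_finsetSum_measure.2 fun j _ => hintj j),
    integral_finsetSum_measure fun j _ => hintj j]
  congr 1
  · rw [integral_withDensity_eq_integral_toReal_smul₀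
      (h.integrable t ht).aestronglyMeasurable.aemeasurable.ennreal_ofReal
      (Eventually.of_forall fun _ => ENNReal.ofReal_lt_top)]
    refine integral_congr_ae ?_
    filter_upwards [h.nonneg] with θ hθ
    rw [ENNReal.toReal_ofReal (hθ t ht)]
  · refine Finset.sum_congr rfl fun j _ => ?_
    rw [integral_smul_measure, integral_dirac, ENNReal.toReal_ofReal (h.mass_nonneg j t ht)]

theorem integrable_deriv (h : IsDifferentiableFamily J θ₀ μ ω γ Ω) (ht : t ∈ J) :
    Integrable (fun θ => deriv (fun τ => ω θ τ) t) (μ.restrict (Ico θ₀ (θ₀ + 2 * Real.pi))) := by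
  obtain ⟨α, hα, hbound⟩ := h.exists_bound
  refine hα.mono' ?_ ?_
  · obtain ⟨ε, hε, hball⟩ := Metric.isOpen_iff.1 h.isOpen t ht
    -- The derivative is measurable as an a.e. limit of difference quotients along `u`. The shift by
    -- `2` keeps `u 0` strictly inside the ball contained in `J`.
    let u : ℕ → ℝ := fun k => t + ε / (k + 2)
    have hu : ∀ k, u k ∈ J := by
      intro k
      refine hball ?_
      have h2 : (0 : ℝ) < k + 2 := by positivity
      rw [Metric.mem_ball, Real.dist_eq]
      simp only [u, add_sub_cancel_left]
      rw [abs_of_pos (by positivity), div_lt_iff₀ h2]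
      nlinarith [(Nat.cast_nonneg k : (0 : ℝ) ≤ k)]
    have hulim : Tendsto u atTop (𝓝[≠] t) := by
      refine tendsto_nhdsWithin_iff.2 ⟨?_, Eventually.of_forall fun k => ?_⟩
      · have h1 : Tendsto (fun k : ℕ => ε / ((k : ℝ) + 2)) atTop (𝓝 0) :=
          Tendsto.const_div_atTop (tendsto_atTop_add_const_right _ _ tendsto_natCast_atTop_atTop) _
        simpa [u] using h1.const_add t
      · have h2 : (0 : ℝ) < k + 2 := by positivity
        have : 0 < ε / (k + 2) := by positivity
        simp only [u, mem_compl_iff, mem_singleton_iff]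
        linarith
    refine aestronglyMeasurable_of_tendsto_ae atTop
      (f := fun k θ => (u k - t)⁻¹ • (ω θ (u k) - ω θ t)) (fun k => ?_) ?_
    · exact ((h.integrable _ (hu k)).sub (h.integrable t ht)).aestronglyMeasurable.const_mul
        (u k - t)⁻¹
    · filter_upwards [h.differentiable] with θ hθ
      exact (hasDerivAt_iff_tendsto_slope.1 (hθ t ht).hasDerivAt).comp hulim
  · filter_upwards [hbound] with θ hθ using hθ t ht

/-- The derivative at `t` of the integral of `g` with respect to the measure at time `t`. -/
def _root_.POPUC.derivIntegral (θ₀ : ℝ) (μ : Measure ℝ) (ω : ℝ → ℝ → ℝ)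
    (γ Ω : Fin (N + 1) → ℝ → ℝ) (t : ℝ) (g : ℝ → E) : E :=
  ∫ θ in Ico θ₀ (θ₀ + 2 * Real.pi), deriv (fun τ => ω θ τ) t • g θ ∂μ
    + ∑ j, (γ j t • deriv (Ω j) t • deriv g (Ω j t) + deriv (γ j) t • g (Ω j t))

/-- The bound `α` permits differentiation under the integral in the density part; each point mass
contributes by the product and chain rules. -/
theorem hasDerivAt_integral (h : IsDifferentiableFamily J θ₀ μ ω γ Ω) (ht : t ∈ J)
    (hg : Differentiable ℝ g) {K : ℝ} (hK : ∀ θ, ‖g θ‖ ≤ K) :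
    HasDerivAt (fun τ => ∫ θ, g θ ∂(mixedMeasure θ₀ μ ω γ Ω τ))
      (derivIntegral θ₀ μ ω γ Ω t g) t := by
  have hJ : J ∈ 𝓝 t := h.isOpen.mem_nhds ht
  have hgc := hg.continuous
  obtain ⟨α, hα, hbound⟩ := h.exists_bound
  have hbdd : ∀ {w : ℝ → ℝ}, Integrable w (μ.restrict (Ico θ₀ (θ₀ + 2 * Real.pi))) →
      Integrable (fun θ => w θ • g θ) (μ.restrict (Ico θ₀ (θ₀ + 2 * Real.pi))) := fun hw =>
    hw.smul_bdd K hgc.aestronglyMeasurable (Eventually.of_forall hK)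
  have h1 : HasDerivAt (fun τ => ∫ θ in Ico θ₀ (θ₀ + 2 * Real.pi), ω θ τ • g θ ∂μ)
      (∫ θ in Ico θ₀ (θ₀ + 2 * Real.pi), deriv (fun τ => ω θ τ) t • g θ ∂μ) t := by
    refine (hasDerivAt_integral_of_dominated_loc_of_deriv_le (bound := fun θ => α θ * K) hJ ?_
      (hbdd (h.integrable t ht)) (F' := fun τ θ => deriv (fun τ => ω θ τ) τ • g θ)
      (hbdd (h.integrable_deriv ht)).aestronglyMeasurable ?_ (hα.mul_const K) ?_).2
    · filter_upwards [hJ] with τ hτ using (hbdd (h.integrable τ hτ)).aestronglyMeasurable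
    · filter_upwards [hbound] with θ hθ τ hτ
      rw [norm_smul, Real.norm_eq_abs]
      exact mul_le_mul (hθ τ hτ) (hK θ) (norm_nonneg _) ((abs_nonneg _).trans (hθ τ hτ))
    · filter_upwards [h.differentiable] with θ hθ τ hτ
      exact (hθ τ hτ).hasDerivAt.smul_const (g θ)
  have h2 : ∀ j, HasDerivAt (fun τ => γ j τ • g (Ω j τ))
      (γ j t • deriv (Ω j) t • deriv g (Ω j t) + deriv (γ j) t • g (Ω j t)) t := fun j =>
    ((h.mass_differentiable j).differentiableAt hJ).hasDerivAt.fun_smul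
      ((hg _).hasDerivAt.scomp t ((h.angle_differentiable j).differentiableAt hJ).hasDerivAt)
  refine (h1.add (HasDerivAt.fun_sum fun j _ => h2 j)).congr_of_eventuallyEq ?_
  filter_upwards [hJ] with τ hτ using h.integral_eq hτ hgc hK

theorem differentiable_eval_pt (p : ℂ[X]) : Differentiable ℝ fun θ => p.eval (pt θ) := by
  intro θ
  exact ((p.differentiable.differentiableAt.restrictScalars ℝ).comp θ
    (hasDerivAt_pt θ).differentiableAt)

theorem hasDerivAt_ip (h : IsDifferentiableFamily J θ₀ μ ω γ Ω) (ht : t ∈ J) (p q : ℂ[X]) :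
    HasDerivAt (fun τ => ip (mixedMeasure θ₀ μ ω γ Ω τ) p q)
      (derivIntegral θ₀ μ ω γ Ω t fun θ => p.eval (pt θ) * conj (q.eval (pt θ))) t := by
  obtain ⟨K, hK⟩ := bounded_comp_pt (continuous_ip_integrand p q)
  refine h.hasDerivAt_integral ht (fun θ => ?_) hK
  exact (differentiable_eval_pt p θ).mul (differentiableAt_conj (differentiable_eval_pt q θ))

end IsDifferentiableFamily

/-! ### Zeros of a moving polynomial via divided differences -/

section DivDiff

/-- The divided difference of a polynomial of degree at most `d`. -/
def divDiff (d : ℕ) (p : ℂ[X]) (z w : ℂ) : ℂ :=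
  ∑ i ∈ Finset.range (d + 1), p.coeff i * ∑ a ∈ Finset.range i, z ^ a * w ^ (i - 1 - a)

theorem divDiff_mul_sub {d : ℕ} {p : ℂ[X]} (hp : p.natDegree ≤ d) (z w : ℂ) :
    divDiff d p z w * (z - w) = p.eval z - p.eval w := by
  rw [eval_eq_sum_range' (Nat.lt_succ_of_le hp), eval_eq_sum_range' (Nat.lt_succ_of_le hp),
    ← Finset.sum_sub_distrib, divDiff, Finset.sum_mul]
  refine Finset.sum_congr rfl fun i _ => ?_
  rw [mul_assoc, geom_sum₂_mul, mul_sub]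

theorem divDiff_self {d : ℕ} {p : ℂ[X]} (hp : p.natDegree ≤ d) (z : ℂ) :
    divDiff d p z z = (derivative p).eval z := by
  rw [derivative_eval, sum_over_range' p (by simp) (d + 1) (Nat.lt_succ_of_le hp), divDiff]
  refine Finset.sum_congr rfl fun i _ => ?_
  rw [geom_sum₂_self, mul_assoc]

theorem eval_eq_prod_roots {p : ℂ[X]} (hp : p.Monic) (z : ℂ) :
    p.eval z = (p.roots.map fun w => z - w).prod := by
  conv_lhs => rw [(IsAlgClosed.splits p).eq_prod_roots_of_monic hp]
  rw [eval_multiset_prod, Multiset.map_map]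
  simp

/-- A monic polynomial with a small value at `z` has a zero close to `z`. -/
theorem exists_root_near {d : ℕ} {p : ℂ[X]} (hp : p.Monic) (hdeg : p.natDegree = d)
    {z : ℂ} {r : ℝ} (hr : 0 ≤ r) (h : ‖p.eval z‖ < r ^ d) :
    ∃ w ∈ Metric.ball z r, p.eval w = 0 := by
  by_contra! hne
  -- The value at `z` is the product of the differences `z - w` over the roots; if all are at least
  -- `r` in modulus, the value is at least `r ^ d`.
  have key : ∀ s : Multiset ℂ, (∀ w ∈ s, r ≤ ‖z - w‖) →
      r ^ s.card ≤ ‖(s.map fun w => z - w).prod‖ := by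
    intro s
    induction s using Multiset.induction_on with
    | empty => simp
    | cons a s ih =>
      intro hs
      rw [Multiset.card_cons, Multiset.map_cons, Multiset.prod_cons, norm_mul, pow_succ']
      exact mul_le_mul (hs a (Multiset.mem_cons_self a s))
        (ih fun w hw => hs w (Multiset.mem_cons_of_mem hw)) (by positivity) (norm_nonneg _)
  have h1 := key p.roots fun w hw => by
    by_contra! hlt
    refine hne w ?_ (isRoot_of_mem_roots hw)
    rwa [Metric.mem_ball', dist_eq_norm]
  rw [← eval_eq_prod_roots hp, ← (IsAlgClosed.splits p).natDegree_eq_card_roots, hdeg] at h1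
  exact absurd h (not_lt.2 h1)

variable {d : ℕ} {P : ℝ → ℂ[X]} {s : ℝ}

/-- At a simple zero the limit is the nonzero derivative. This joint continuity replaces the
continuous differentiability required by the implicit function theorem. -/
theorem tendsto_divDiff (hc : ∀ i, ContinuousAt (fun t => (P t).coeff i) s) (z : ℂ) :
    Tendsto (fun x : ℝ × ℂ × ℂ => divDiff d (P x.1) x.2.1 x.2.2) (𝓝 (s, z, z))
      (𝓝 (divDiff d (P s) z z)) := by
  unfold divDiff
  have h : ∀ i, ContinuousAt (fun x : ℝ × ℂ × ℂ => (P x.1).coeff i) (s, z, z) := fun i =>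
    ContinuousAt.comp (g := fun t => (P t).coeff i) (f := Prod.fst) (hc i) continuousAt_fst
  refine tendsto_finsetSum _ fun i _ => (h i).mul ?_
  exact Continuous.tendsto (by fun_prop : Continuous fun x : ℝ × ℂ × ℂ =>
    ∑ a ∈ Finset.range i, x.2.1 ^ a * x.2.2 ^ (i - 1 - a)) (s, z, z)

attribute [irreducible] divDiff

/-- Near a simple zero there is at most one zero. -/
theorem eventually_root_unique (hdeg : ∀ᶠ t in 𝓝 s, (P t).natDegree = d)
    (hc : ∀ i, ContinuousAt (fun t => (P t).coeff i) s) {z₀ : ℂ}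
    (hz : (derivative (P s)).eval z₀ ≠ 0) :
    ∃ δ > 0, ∀ᶠ t in 𝓝 s, ∀ z ∈ Metric.ball z₀ δ, ∀ w ∈ Metric.ball z₀ δ,
      (P t).eval z = 0 → (P t).eval w = 0 → z = w := by
  have hds : (P s).natDegree = d := hdeg.self_of_nhds
  have hz' : divDiff d (P s) z₀ z₀ ≠ 0 := by rwa [divDiff_self hds.le]
  have h := (tendsto_divDiff hc z₀).eventually_ne hz'
  rw [nhds_prod_eq, nhds_prod_eq] at h
  obtain ⟨p, hp, q, hq, hpq⟩ := eventually_prod_iff.1 h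
  obtain ⟨q₁, hq₁, q₂, hq₂, hqq⟩ := eventually_prod_iff.1 hq
  obtain ⟨δ, hδ, hball⟩ := Metric.eventually_nhds_iff_ball.1 (hq₁.and hq₂)
  refine ⟨δ, hδ, ?_⟩
  filter_upwards [hp, hdeg] with t ht htd z hz w hw hz0 hw0
  have h1 := divDiff_mul_sub htd.le z w
  rw [hz0, hw0, sub_zero] at h1
  exact sub_eq_zero.1 ((mul_eq_zero.1 h1).resolve_left
    (hpq ht (hqq (hball z hz).1 (hball w hw).2)))

theorem differentiableAt_eval (hdeg : ∀ᶠ t in 𝓝 s, (P t).natDegree = d)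
    (hc : ∀ i, DifferentiableAt ℝ (fun t => (P t).coeff i) s) (z : ℂ) :
    DifferentiableAt ℝ (fun t => (P t).eval z) s := by
  have : DifferentiableAt ℝ (fun t => ∑ i ∈ Finset.range (d + 1), (P t).coeff i * z ^ i) s :=
    DifferentiableAt.fun_sum fun i _ => (hc i).mul_const _
  refine this.congr_of_eventuallyEq ?_
  filter_upwards [hdeg] with t ht
  exact eval_eq_sum_range' (by rw [ht]; exact Nat.lt_succ_self d) z

theorem eventually_exists_root (hmonic : ∀ᶠ t in 𝓝 s, (P t).Monic)
    (hdeg : ∀ᶠ t in 𝓝 s, (P t).natDegree = d)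
    (hc : ∀ i, DifferentiableAt ℝ (fun t => (P t).coeff i) s) {z₀ : ℂ}
    (hz : (P s).eval z₀ = 0) {r : ℝ} (hr : 0 < r) :
    ∀ᶠ t in 𝓝 s, ∃ w ∈ Metric.ball z₀ r, (P t).eval w = 0 := by
  have h1 := (differentiableAt_eval hdeg hc z₀).continuousAt.norm
  have h2 : ∀ᶠ t in 𝓝 s, ‖(P t).eval z₀‖ < r ^ d := by
    refine h1.eventually_lt_const ?_
    simp only [hz, norm_zero]; positivity
  filter_upwards [h2, hmonic, hdeg] with t ht hm hdt
  exact exists_root_near hm hdt hr.le ht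

/-- A continuous branch of simple zeros is differentiable. -/
theorem differentiableAt_root (hdeg : ∀ᶠ t in 𝓝 s, (P t).natDegree = d)
    (hc : ∀ i, DifferentiableAt ℝ (fun t => (P t).coeff i) s) {ζ : ℝ → ℂ}
    (hζ : ContinuousAt ζ s) (h0 : ∀ᶠ t in 𝓝 s, (P t).eval (ζ t) = 0)
    (hz : (derivative (P s)).eval (ζ s) ≠ 0) : DifferentiableAt ℝ ζ s := by
  have hds : (P s).natDegree = d := hdeg.self_of_nhds
  have hz' : divDiff d (P s) (ζ s) (ζ s) ≠ 0 := by rwa [divDiff_self hds.le]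
  have h1 : Tendsto (fun t => divDiff d (P t) (ζ t) (ζ s)) (𝓝 s)
      (𝓝 (divDiff d (P s) (ζ s) (ζ s))) :=
    (tendsto_divDiff (fun i => (hc i).continuousAt) (ζ s)).comp
      (tendsto_id.prodMk_nhds (Tendsto.prodMk_nhds hζ tendsto_const_nhds))
  have h2 := hasDerivAt_iff_tendsto_slope.1 (differentiableAt_eval hdeg hc (ζ s)).hasDerivAt
  -- Since `P t` vanishes at `ζ t`, the slope of `ζ` is minus the slope of `t ↦ P t (ζ s)` divided
  -- by the divided difference of `P t` at `ζ t`, `ζ s`.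
  have h3 := (h2.neg.div (h1.mono_left nhdsWithin_le_nhds) hz')
  refine (hasDerivAt_iff_tendsto_slope.2 (h3.congr' ?_)).differentiableAt
  have h4 : ∀ᶠ t in 𝓝 s, (P t).natDegree = d ∧ (P t).eval (ζ t) = 0 ∧
      divDiff d (P t) (ζ t) (ζ s) ≠ 0 := hdeg.and (h0.and (h1.eventually_ne hz'))
  filter_upwards [nhdsWithin_le_nhds h4] with t ht
  obtain ⟨hdt, ht0, htne⟩ := ht
  have h5 := divDiff_mul_sub hdt.le (ζ t) (ζ s)
  simp only [Pi.div_apply]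
  rw [div_eq_iff htne, slope_def_module, slope_def_module, smul_mul_assoc, ← smul_neg]
  congr 1
  rw [mul_comm, h5, h0.self_of_nhds, ht0]
  ring

end DivDiff

/-! ### Existence, uniqueness and separation of branches of zeros -/

section Branch

theorem nbhd_mem_nhds {t₀ ε t : ℝ} (ht : t ∈ nbhd t₀ ε) : nbhd t₀ ε ∈ 𝓝 t :=
  isOpen_Ioo.mem_nhds ht

theorem mem_nbhd_self {t₀ ε : ℝ} (hε : 0 < ε) : t₀ ∈ nbhd t₀ ε :=
  ⟨by linarith, by linarith⟩

theorem exists_nbhd_of_eventually {p : ℝ → Prop} {t₀ : ℝ} (h : ∀ᶠ t in 𝓝 t₀, p t) :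
    ∃ ε > 0, ∀ t ∈ nbhd t₀ ε, p t := by
  obtain ⟨ε, hε, hb⟩ := Metric.eventually_nhds_iff_ball.1 h
  refine ⟨ε, hε, fun t ht => hb t ?_⟩
  rwa [Real.ball_eq_Ioo]

variable {J : Set ℝ} {θ₀ : ℝ} {μ : Measure ℝ} {ω : ℝ → ℝ → ℝ} {N : ℕ}
  {γ Ω : Fin (N + 1) → ℝ → ℝ} {n : ℕ} {b : ℝ → ℂ} {P : ℝ → ℂ[X]}

theorem IsDifferentiableFamily.eventually_isFiniteMeasure
    (h : IsDifferentiableFamily J θ₀ μ ω γ Ω) {s : ℝ} (hs : s ∈ J) :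
    ∀ᶠ t in 𝓝 s, IsFiniteMeasure (mixedMeasure θ₀ μ ω γ Ω t) := by
  filter_upwards [h.isOpen.mem_nhds hs] with t ht using h.isFiniteMeasure ht

/-- The coefficients of the paraorthogonal polynomials are differentiable. -/
theorem IsDifferentiableFamily.differentiableAt_coeff (h : IsDifferentiableFamily J θ₀ μ ω γ Ω)
    (hP : ∀ t ∈ J, IsPOPUC (mixedMeasure θ₀ μ ω γ Ω t) n (b t) (P t)) {s : ℝ} (hs : s ∈ J)
    (hb : DifferentiableAt ℝ b s ∨ ∀ᶠ t in 𝓝 s, (P t).eval (pt θ₀) = 0) (i : ℕ) :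
    DifferentiableAt ℝ (fun t => (P t).coeff i) s := by
  have hfin := h.eventually_isFiniteMeasure hs
  have hip := fun p q => (h.hasDerivAt_ip hs p q).differentiableAt
  have hP' := Filter.Eventually.mono (h.isOpen.mem_nhds hs) hP
  refine differentiableAt_coeff_POPUC hfin (h.support s hs) hip hP' ?_ i
  exact hb.elim id fun h0 =>
    differentiableAt_parameter hfin (h.support s hs) hip hP' (norm_pt θ₀) h0

theorem IsDifferentiableFamily.eventually_natDegree (h : IsDifferentiableFamily J θ₀ μ ω γ Ω)
    (hP : ∀ t ∈ J, IsPOPUC (mixedMeasure θ₀ μ ω γ Ω t) n (b t) (P t)) {s : ℝ} (hs : s ∈ J) :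
    ∀ᶠ t in 𝓝 s, (P t).natDegree = n + 1 :=
  Filter.Eventually.mono (h.isOpen.mem_nhds hs) fun t ht => (hP t ht).natDegree

theorem IsDifferentiableFamily.derivative_ne_zero (h : IsDifferentiableFamily J θ₀ μ ω γ Ω)
    (hP : ∀ t ∈ J, IsPOPUC (mixedMeasure θ₀ μ ω γ Ω t) n (b t) (P t)) {s : ℝ} (hs : s ∈ J) {z : ℂ}
    (hz : (P s).eval z = 0) : (derivative (P s)).eval z ≠ 0 := by
  have := h.isFiniteMeasure hs
  exact (hP s hs).derivative_ne_zero (h.support s hs) hz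

/-- For `t` near `t₀` a small ball around `ζ₀` contains exactly one zero, since `ζ₀` is simple. That
zero is the branch; its uniqueness also yields continuity, and simplicity then gives
differentiability. -/
theorem IsDifferentiableFamily.exists_branch (h : IsDifferentiableFamily J θ₀ μ ω γ Ω)
    (hP : ∀ t ∈ J, IsPOPUC (mixedMeasure θ₀ μ ω γ Ω t) n (b t) (P t))
    (hc : ∀ s ∈ J, ∀ i, DifferentiableAt ℝ (fun t => (P t).coeff i) s) {t₀ : ℝ} (ht₀ : t₀ ∈ J)
    {ζ₀ : ℂ} (hζ₀ : (P t₀).eval ζ₀ = 0) :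
    ∃ ε > 0, ∃ δ > 0, nbhd t₀ ε ⊆ J ∧ ∃ ζ : ℝ → ℂ, IsZeroBranch P t₀ ζ₀ ε δ ζ ∧
      ∀ η : ℝ → ℂ, IsZeroBranch P t₀ ζ₀ ε δ η → EqOn η ζ (nbhd t₀ ε) := by
  have hmonic : ∀ s ∈ J, ∀ᶠ t in 𝓝 s, (P t).Monic := fun s hs =>
    Filter.Eventually.mono (h.isOpen.mem_nhds hs) fun t ht => (hP t ht).monic
  have hdeg : ∀ s ∈ J, ∀ᶠ t in 𝓝 s, (P t).natDegree = n + 1 := fun s hs =>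
    h.eventually_natDegree hP hs
  obtain ⟨δ, hδ, huniq⟩ := eventually_root_unique (hdeg t₀ ht₀)
    (fun i => (hc t₀ ht₀ i).continuousAt) (h.derivative_ne_zero hP ht₀ hζ₀)
  have hex := eventually_exists_root (hmonic t₀ ht₀) (hdeg t₀ ht₀) (hc t₀ ht₀) hζ₀ hδ
  obtain ⟨ε, hε, hI⟩ := exists_nbhd_of_eventually
    ((h.isOpen.eventually_mem ht₀).and (huniq.and hex))
  replace hex : ∀ t, ∃ w, t ∈ nbhd t₀ ε → w ∈ Metric.ball ζ₀ δ ∧ (P t).eval w = 0 := by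
    intro t
    by_cases ht : t ∈ nbhd t₀ ε
    · obtain ⟨w, hw⟩ := (hI t ht).2.2
      exact ⟨w, fun _ => hw⟩
    · exact ⟨0, fun h => absurd h ht⟩
  choose ζ hζ using hex
  have hu : ∀ t ∈ nbhd t₀ ε, ∀ w ∈ Metric.ball ζ₀ δ, (P t).eval w = 0 → w = ζ t :=
    fun t ht w hw hw0 => (hI t ht).2.1 w hw (ζ t) (hζ t ht).1 hw0 (hζ t ht).2
  refine ⟨ε, hε, δ, hδ, fun t ht => (hI t ht).1, ζ, ⟨fun t ht => ⟨?_, (hζ t ht).1⟩, ?_, ?_,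
    fun t ht => (hζ t ht).2⟩, fun η hη t ht => hu t ht _ (hη.mem_arc t ht).2 (hη.zero t ht)⟩
  · have := h.isFiniteMeasure (hI t ht).1
    exact (hP t (hI t ht).1).norm_eq_one (h.support t (hI t ht).1) (hζ t ht).2
  · intro s hs
    have hsJ := (hI s hs).1
    refine (differentiableAt_root (hdeg s hsJ) (hc s hsJ) ?_ ?_
      (h.derivative_ne_zero hP hsJ (hζ s hs).2)).differentiableWithinAt
    · rw [Metric.continuousAt_iff']
      intro r hr
      have hb : Metric.ball ζ₀ δ ∈ 𝓝 (ζ s) := Metric.isOpen_ball.mem_nhds (hζ s hs).1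
      -- Within `r'` of `ζ s` every zero lies in the `δ`-ball, so the nearby zero found at time `t`
      -- must be `ζ t`.
      obtain ⟨r', hr', hsub⟩ := Metric.mem_nhds_iff.1 hb
      filter_upwards [nbhd_mem_nhds hs, eventually_exists_root (hmonic s hsJ)
        (hdeg s hsJ) (hc s hsJ) (hζ s hs).2 (lt_min hr hr')] with t ht hw
      obtain ⟨w, hw, hw0⟩ := hw
      rw [← hu t ht w (hsub (Metric.ball_subset_ball (min_le_right _ _) hw)) hw0]
      exact Metric.ball_subset_ball (min_le_left _ _) hw
    · filter_upwards [nbhd_mem_nhds hs] with t ht using (hζ t ht).2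
  · exact (hu t₀ (mem_nbhd_self hε) ζ₀ (Metric.mem_ball_self hδ) hζ₀).symm

/-- A branch of zeros that starts away from a fixed zero never meets it. -/
theorem IsDifferentiableFamily.branch_ne (h : IsDifferentiableFamily J θ₀ μ ω γ Ω)
    (hP : ∀ t ∈ J, IsPOPUC (mixedMeasure θ₀ μ ω γ Ω t) n (b t) (P t)) {I : Set ℝ} (hI : IsOpen I)
    (hIc : IsPreconnected I) (hIJ : I ⊆ J)
    (hc : ∀ s ∈ I, ∀ i, DifferentiableAt ℝ (fun t => (P t).coeff i) s) {ζ : ℝ → ℂ}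
    (hζ : ContinuousOn ζ I) (h0 : ∀ t ∈ I, (P t).eval (ζ t) = 0) {z : ℂ}
    (hz : ∀ t ∈ I, (P t).eval z = 0) {t₀ : ℝ} (ht₀ : t₀ ∈ I) (hne : ζ t₀ ≠ z) :
    ∀ t ∈ I, ζ t ≠ z := by
  -- Simple zeros are locally unique, so the coincidence set is open; continuity makes its
  -- complement open, and connectedness decides.
  have hopen : IsOpen (I ∩ {t | ζ t = z}) := by
    rw [isOpen_iff_mem_nhds]
    rintro s ⟨hs, hsz⟩
    obtain ⟨δ, hδ, huniq⟩ := eventually_root_unique (h.eventually_natDegree hP (hIJ hs))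
      (fun i => (hc s hs i).continuousAt) (h.derivative_ne_zero hP (hIJ hs) (hz s hs))
    have hball : ∀ᶠ t in 𝓝 s, ζ t ∈ Metric.ball z δ := by
      refine (hζ.continuousAt (hI.mem_nhds hs)).eventually_mem ?_
      rw [hsz]; exact Metric.ball_mem_nhds z hδ
    filter_upwards [hI.mem_nhds hs, huniq, hball] with t ht hu hb
    exact ⟨ht, hu _ hb _ (Metric.mem_ball_self hδ) (h0 t ht) (hz t ht)⟩
  have hopen' : IsOpen (I ∩ {t | ζ t ≠ z}) := hζ.isOpen_inter_preimage hI isOpen_ne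
  intro t ht htz
  obtain ⟨x, -, hx, hx'⟩ := hIc _ _ hopen hopen'
    (fun x hx => (em (ζ x = z)).imp (fun h => ⟨hx, h⟩) fun h => ⟨hx, h⟩)
    ⟨t, ht, ht, htz⟩ ⟨t₀, ht₀, ht₀, hne⟩
  exact hx'.2 hx.2

end Branch

/-! ### First variation of paraorthogonality -/

section Variation

/-- The polynomial `∑ p_i'(s) X ^ i` for the coefficients `p_i` of `P`. -/
def coeffDeriv (d : ℕ) (P : ℝ → ℂ[X]) (s : ℝ) : ℂ[X] :=
  ∑ i ∈ Finset.range (d + 1), C (deriv (fun t => (P t).coeff i) s) * X ^ i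

theorem natDegree_coeffDeriv_le (d : ℕ) (P : ℝ → ℂ[X]) (s : ℝ) :
    (coeffDeriv d P s).natDegree ≤ d :=
  natDegree_sum_le_of_forall_le _ _ fun _ hi =>
    (natDegree_C_mul_X_pow_le _ _).trans (Nat.lt_succ_iff.1 (Finset.mem_range.1 hi))

variable {d : ℕ} {P : ℝ → ℂ[X]} {s : ℝ}

theorem hasDerivAt_eval_comp (hdeg : ∀ᶠ t in 𝓝 s, (P t).natDegree = d)
    (hc : ∀ i, DifferentiableAt ℝ (fun t => (P t).coeff i) s) {ζ : ℝ → ℂ} {ζ' : ℂ}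
    (hζ : HasDerivAt ζ ζ' s) :
    HasDerivAt (fun t => (P t).eval (ζ t))
      ((coeffDeriv d P s).eval (ζ s) + ζ' * (derivative (P s)).eval (ζ s)) s := by
  have hds : (P s).natDegree = d := hdeg.self_of_nhds
  have h1 : HasDerivAt (fun t => ∑ i ∈ Finset.range (d + 1), (P t).coeff i * ζ t ^ i)
      (∑ i ∈ Finset.range (d + 1), (deriv (fun t => (P t).coeff i) s * ζ s ^ i
        + (P s).coeff i * (i * ζ s ^ (i - 1) * ζ'))) s :=
    HasDerivAt.fun_sum fun i _ => (hc i).hasDerivAt.fun_mul (hζ.fun_pow i)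
  have h2 : (coeffDeriv d P s).eval (ζ s) + ζ' * (derivative (P s)).eval (ζ s)
      = ∑ i ∈ Finset.range (d + 1), (deriv (fun t => (P t).coeff i) s * ζ s ^ i
        + (P s).coeff i * (i * ζ s ^ (i - 1) * ζ')) := by
    rw [derivative_eval, sum_over_range' (P s) (by simp) (d + 1) (Nat.lt_succ_of_le hds.le),
      coeffDeriv, eval_finsetSum, Finset.mul_sum, ← Finset.sum_add_distrib]
    refine Finset.sum_congr rfl fun i _ => ?_
    simp only [eval_mul, eval_C, eval_pow, eval_X]
    ring
  rw [h2]
  refine h1.congr_of_eventuallyEq ?_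
  filter_upwards [hdeg] with t ht
  exact eval_eq_sum_range' (by rw [ht]; exact Nat.lt_succ_self d) _

variable {J : Set ℝ} {θ₀ : ℝ} {μ : Measure ℝ} {ω : ℝ → ℝ → ℝ} {N : ℕ}
  {γ Ω : Fin (N + 1) → ℝ → ℝ} {n : ℕ} {b : ℝ → ℂ}

/-- A product rule: expansion in monomials separates the motion of the coefficients from that of the
measure. -/
theorem IsDifferentiableFamily.hasDerivAt_ip_left (h : IsDifferentiableFamily J θ₀ μ ω γ Ω)
    (hs : s ∈ J) (hdeg : ∀ᶠ t in 𝓝 s, (P t).natDegree = d)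
    (hc : ∀ i, DifferentiableAt ℝ (fun t => (P t).coeff i) s) (q : ℂ[X]) :
    HasDerivAt (fun t => ip (mixedMeasure θ₀ μ ω γ Ω t) (P t) q)
      (ip (mixedMeasure θ₀ μ ω γ Ω s) (coeffDeriv d P s) q
        + derivIntegral θ₀ μ ω γ Ω s fun θ => (P s).eval (pt θ) * conj (q.eval (pt θ))) s := by
  have hds : (P s).natDegree = d := hdeg.self_of_nhds
  have hfin := h.eventually_isFiniteMeasure hs
  have := h.isFiniteMeasure hs
  have hexp : ∀ (t : ℝ) (p : ℂ[X]), IsFiniteMeasure (mixedMeasure θ₀ μ ω γ Ω t) →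
      p.natDegree = d → ip (mixedMeasure θ₀ μ ω γ Ω t) p q
        = ∑ i ∈ Finset.range (d + 1), p.coeff i * ip (mixedMeasure θ₀ μ ω γ Ω t) (X ^ i) q := by
    intro t p ht hp
    conv_lhs => rw [p.as_sum_range_C_mul_X_pow' (n := d + 1) (by omega)]
    rw [ip_sum_left]
    exact Finset.sum_congr rfl fun i _ => ip_C_mul_left _ _ _ _
  let D : ℕ → ℂ := fun i =>
    derivIntegral θ₀ μ ω γ Ω s fun θ => (X ^ i : ℂ[X]).eval (pt θ) * conj (q.eval (pt θ))
  have hD : ∀ i, HasDerivAt (fun t => ip (mixedMeasure θ₀ μ ω γ Ω t) (X ^ i) q) (D i) s :=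
    fun i => h.hasDerivAt_ip hs (X ^ i) q
  have h1 : HasDerivAt (fun t => ∑ i ∈ Finset.range (d + 1),
      (P t).coeff i * ip (mixedMeasure θ₀ μ ω γ Ω t) (X ^ i) q)
      (∑ i ∈ Finset.range (d + 1), (deriv (fun t => (P t).coeff i) s
        * ip (mixedMeasure θ₀ μ ω γ Ω s) (X ^ i) q + (P s).coeff i * D i)) s :=
    HasDerivAt.fun_sum fun i _ => (hc i).hasDerivAt.fun_mul (hD i)
  have h2 : HasDerivAt (fun t => ip (mixedMeasure θ₀ μ ω γ Ω t) (P s) q)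
      (∑ i ∈ Finset.range (d + 1), (P s).coeff i * D i) s := by
    refine (HasDerivAt.fun_sum fun i _ => (hD i).const_mul ((P s).coeff i)).congr_of_eventuallyEq
      (f := fun t => ∑ i ∈ Finset.range (d + 1),
        (P s).coeff i * ip (mixedMeasure θ₀ μ ω γ Ω t) (X ^ i) q) ?_
    filter_upwards [hfin] with t ht using hexp t _ ht hds
  rw [Finset.sum_add_distrib, ← h2.unique (h.hasDerivAt_ip hs (P s) q)] at *
  have h3 : ip (mixedMeasure θ₀ μ ω γ Ω s) (coeffDeriv d P s) q
      = ∑ i ∈ Finset.range (d + 1), deriv (fun t => (P t).coeff i) s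
        * ip (mixedMeasure θ₀ μ ω γ Ω s) (X ^ i) q := by
    rw [coeffDeriv, ip_sum_left]
    exact Finset.sum_congr rfl fun i _ => ip_C_mul_left _ _ _ _
  rw [h3]
  refine h1.congr_of_eventuallyEq ?_
  filter_upwards [hfin, hdeg] with t ht hdt using hexp t _ ht hdt

/-- Two zeros on the circle can be exchanged between the two sides of the sesquilinear form. -/
theorem ip_swap (m : Measure ℝ) {z w : ℂ} (hz : ‖z‖ = 1) (hw : ‖w‖ = 1) (p q : ℂ[X]) :
    ip m ((X - C z) * (X - C w) * p) (X * q)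
      = z * w * conj (ip m ((X - C z) * (X - C w) * q) (X * p)) := by
  rw [ip, ip, ← integral_conj, ← integral_const_mul]
  congr 1; ext θ
  have h1 := pt_mul_conj θ
  have h2 := mul_conj_of_norm_eq_one hz
  have h3 := mul_conj_of_norm_eq_one hw
  -- On the circle `(x - z)(x - w) conj x` equals `z w` times its own conjugate.
  have h4 : (pt θ - z) * (pt θ - w) * conj (pt θ)
      = z * w * (conj (pt θ) - conj z) * (conj (pt θ) - conj w) * pt θ := by
    linear_combination (pt θ - z - w + z * w * (conj z + conj w) - z * w * conj (pt θ)) * h1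
      - (pt θ * w * conj w - w) * h2 - (pt θ - z) * h3
  simp only [eval_mul, eval_sub, eval_X, eval_C, map_mul, map_sub, Complex.conj_conj]
  linear_combination (eval (pt θ) p * conj (eval (pt θ) q)) * h4

variable {ζ : ℝ → ℂ} {ζ' w : ℂ} {R : ℂ[X]}

/-- The velocity `ζ'` of a zero in the presence of a fixed zero `w`, in terms of the derivative of
the measure. -/
theorem IsDifferentiableFamily.derivIntegral_eq (h : IsDifferentiableFamily J θ₀ μ ω γ Ω)
    (hP : ∀ t ∈ J, IsPOPUC (mixedMeasure θ₀ μ ω γ Ω t) n (b t) (P t)) (hs : s ∈ J)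
    (hc : ∀ i, DifferentiableAt ℝ (fun t => (P t).coeff i) s) (hζ : HasDerivAt ζ ζ' s)
    (h0 : ∀ᶠ t in 𝓝 s, (P t).eval (ζ t) = 0) (hw : ∀ᶠ t in 𝓝 s, (P t).eval w = 0)
    (hne : ζ s ≠ w) (hR : P s = (X - C (ζ s)) * (X - C w) * R) :
    derivIntegral θ₀ μ ω γ Ω s
        (fun θ => (P s).eval (pt θ) * conj ((X * R).eval (pt θ)))
      = ζ' * ip (mixedMeasure θ₀ μ ω γ Ω s) ((X - C w) * R) (X * R) := by
  have hdeg := h.eventually_natDegree hP hs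
  have := h.isFiniteMeasure hs
  have hPs := hP s hs
  have hζ1 : ‖ζ s‖ = 1 := hPs.norm_eq_one (h.support s hs) h0.self_of_nhds
  have hw1 : ‖w‖ = 1 := hPs.norm_eq_one (h.support s hs) hw.self_of_nhds
  have hR0 : R ≠ 0 := fun h0 => hPs.monic.ne_zero (by rw [hR, h0, mul_zero])
  have hquad : ∀ T : ℂ[X], T ≠ 0 →
      ((X - C (ζ s)) * (X - C w) * T).natDegree = T.natDegree + 2 := by
    intro T hT
    rw [natDegree_mul (mul_ne_zero (X_sub_C_ne_zero _) (X_sub_C_ne_zero _)) hT,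
      natDegree_mul (X_sub_C_ne_zero _) (X_sub_C_ne_zero _), natDegree_X_sub_C, natDegree_X_sub_C]
    omega
  have hRdeg : R.natDegree + 2 = n + 1 := by rw [← hquad R hR0, ← hR, hPs.natDegree]
  have hRlt : R.degree < n := by
    rw [degree_eq_natDegree hR0]; exact_mod_cast (by omega : R.natDegree < n)
  -- Paraorthogonality holds at all nearby times against the test polynomial `X * R` frozen at time
  -- `s`, so its derivative is zero.
  have h1 : ip (mixedMeasure θ₀ μ ω γ Ω s) (coeffDeriv (n + 1) P s) (X * R)
      + derivIntegral θ₀ μ ω γ Ω s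
        (fun θ => (P s).eval (pt θ) * conj ((X * R).eval (pt θ))) = 0 := by
    refine (h.hasDerivAt_ip_left hs hdeg hc (X * R)).unique
      ((hasDerivAt_const s (0 : ℂ)).congr_of_eventuallyEq ?_)
    filter_upwards [h.isOpen.mem_nhds hs] with t ht
    have := h.isFiniteMeasure ht
    exact (hP t ht).ip_eq_zero hRlt
  have h2 : (coeffDeriv (n + 1) P s).eval w = 0 := by
    have := (hasDerivAt_eval_comp hdeg hc (hasDerivAt_const s w)).unique
      ((hasDerivAt_const s (0 : ℂ)).congr_of_eventuallyEq hw)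
    simpa using this
  have h3 : (coeffDeriv (n + 1) P s).eval (ζ s) + ζ' * ((ζ s - w) * R.eval (ζ s)) = 0 := by
    have := (hasDerivAt_eval_comp hdeg hc hζ).unique
      ((hasDerivAt_const s (0 : ℂ)).congr_of_eventuallyEq h0)
    rw [hR] at this
    simpa [derivative_mul] using this
  -- Adding `ζ' (X - w) R` cancels the value of the variation at `ζ s` and leaves its zero at `w`
  -- intact.
  obtain ⟨T, hT⟩ : (X - C (ζ s)) * (X - C w) ∣
      coeffDeriv (n + 1) P s + C ζ' * ((X - C w) * R) := by
    refine IsCoprime.mul_dvd (isCoprime_X_sub_C_of_isUnit_sub (sub_ne_zero.2 hne).isUnit)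
      (dvd_iff_isRoot.2 ?_) (dvd_iff_isRoot.2 ?_)
    · rw [IsRoot.def, eval_add, ← h3]; simp
    · rw [IsRoot.def, eval_add, h2]; simp
  have h4 : ip (mixedMeasure θ₀ μ ω γ Ω s) ((X - C (ζ s)) * (X - C w) * T) (X * R) = 0 := by
    by_cases hT0 : T = 0
    · rw [hT0, mul_zero, ip_zero_left]
    rw [ip_swap _ hζ1 hw1, ← hR, hPs.ip_eq_zero, map_zero, mul_zero]
    have h5 : (coeffDeriv (n + 1) P s + C ζ' * ((X - C w) * R)).natDegree ≤ n + 1 := by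
      refine natDegree_add_le_of_degree_le (natDegree_coeffDeriv_le _ _ _) ?_
      refine (natDegree_C_mul_le _ _).trans ?_
      rw [natDegree_mul (X_sub_C_ne_zero _) hR0, natDegree_X_sub_C]
      omega
    rw [hT, hquad T hT0] at h5
    rw [degree_eq_natDegree hT0]; exact_mod_cast (by omega : T.natDegree < n)
  rw [← hT, ip_add_left, ip_C_mul_left] at h4
  linear_combination h1 - h4

/-- With `A = (X - w) R`, the hypothesis reads `⟨A, R⟩ = z ⟨A, X R⟩`; expanding the second `A` in
`⟨A, A⟩` gives the result. It turns the coefficient of the velocity into a positive norm with an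
explicit phase. -/
theorem ip_fixed_factor {m : Measure ℝ} [IsFiniteMeasure m] {z w : ℂ} {R : ℂ[X]}
    (h : ip m ((X - C z) * (X - C w) * R) (X * R) = 0) :
    (1 - conj w * z) * ip m ((X - C w) * R) (X * R) = ip m ((X - C w) * R) ((X - C w) * R) := by
  have h1 : (X - C z) * (X - C w) * R = X * ((X - C w) * R) - C z * ((X - C w) * R) := by ring
  have h2 : ip m ((X - C w) * R) ((X - C w) * R)
      = ip m ((X - C w) * R) (X * R + C (-w) * R) := by
    congr 1; rw [C_neg]; ring
  rw [h1, ip_sub_left, ip_X_mul, ip_C_mul_left] at h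
  rw [h2, ip_add_right, ip_C_mul_right, map_neg]
  linear_combination (conj w) * h

end Variation

/-! ### Half-angle formulas and logarithmic derivatives -/

section Trigonometry

theorem pt_sub_pt (a b : ℝ) :
    pt a - pt b = pt ((a + b) / 2) * (2 * Complex.I * Real.sin ((a - b) / 2)) := by
  have h : ∀ x : ℝ, 2 * Complex.I * (Real.sin x : ℂ) = pt x - pt (-x) := by
    intro x
    rw [Complex.ofReal_sin, Complex.sin, pt, pt]
    push_cast
    linear_combination (Complex.exp (-↑x * Complex.I) - Complex.exp (↑x * Complex.I))
      * Complex.I_mul_I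
  rw [h, mul_sub, ← pt_add, ← pt_add]
  rw [show (a + b) / 2 + (a - b) / 2 = a by ring, show (a + b) / 2 + -((a - b) / 2) = b by ring]

theorem norm_sq_pt_sub_pt (a b : ℝ) : ‖pt a - pt b‖ ^ 2 = 4 * Real.sin ((a - b) / 2) ^ 2 := by
  rw [pt_sub_pt, norm_mul, norm_pt, norm_mul, norm_mul, Complex.norm_real, Real.norm_eq_abs]
  simp only [Complex.norm_ofNat, Complex.norm_I]
  rw [one_mul, mul_one, mul_pow, sq_abs]
  norm_num

theorem sin_ne_zero_of_pt_ne {a b : ℝ} (h : pt a ≠ pt b) : Real.sin ((a - b) / 2) ≠ 0 := by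
  intro h0
  exact sub_ne_zero.2 h (by rw [pt_sub_pt, h0]; simp)

theorem hasDerivAt_sin_half (a θ : ℝ) (h : Real.sin ((θ - a) / 2) ≠ 0) :
    HasDerivAt (fun θ => Real.sin ((θ - a) / 2))
      (-(1 / 2 * Real.cot ((a - θ) / 2)) * Real.sin ((θ - a) / 2)) θ := by
  have h1 : HasDerivAt (fun θ : ℝ => (θ - a) / 2) (1 / 2) θ :=
    ((hasDerivAt_id θ).sub_const a).div_const 2
  have h2 : (a - θ) / 2 = -((θ - a) / 2) := by ring
  convert h1.sin using 1
  rw [h2, Real.cot_eq_cos_div_sin, Real.cos_neg, Real.sin_neg]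
  field_simp

theorem hasDerivAt_norm_sq (a θ : ℝ) (h : pt θ ≠ pt a) :
    HasDerivAt (fun θ => ‖pt θ - pt a‖ ^ 2) (-Real.cot ((a - θ) / 2) * ‖pt θ - pt a‖ ^ 2) θ := by
  have h1 := ((hasDerivAt_sin_half a θ (sin_ne_zero_of_pt_ne h)).fun_pow 2).const_mul 4
  simp_rw [norm_sq_pt_sub_pt]
  refine h1.congr_deriv ?_
  push_cast
  ring

/-- The cotangent of half the angle between two points does not depend on the choice of the
angle. -/
theorem cot_half_eq {a b θ : ℝ} (hab : pt a = pt b) (h : pt θ ≠ pt a) :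
    Real.cot ((a - θ) / 2) = Real.cot ((b - θ) / 2) := by
  -- Both cotangents are minus the logarithmic derivative of the same function of `θ`.
  have h1 := hasDerivAt_norm_sq a θ h
  have h2 := hasDerivAt_norm_sq b θ (hab ▸ h)
  rw [← hab] at h2
  have h3 : ‖pt θ - pt a‖ ^ 2 ≠ 0 := by
    have := sub_ne_zero.2 h
    positivity
  exact neg_injective (mul_right_cancel₀ h3 (h1.unique h2))

theorem hasDerivAt_prod_norm_sq (r : Multiset ℂ) (θ : ℝ) (h1 : ∀ z ∈ r, ‖z‖ = 1)
    (hne : ∀ z ∈ r, pt θ ≠ z) :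
    HasDerivAt (fun θ => (r.map fun z => ‖pt θ - z‖ ^ 2).prod)
      (-(r.map fun z => Real.cot ((Complex.arg z - θ) / 2)).sum
        * (r.map fun z => ‖pt θ - z‖ ^ 2).prod) θ := by
  induction r using Multiset.induction_on with
  | empty => simpa using hasDerivAt_const θ (1 : ℝ)
  | cons a r ih =>
    have hr := ih (fun z hz => h1 z (Multiset.mem_cons_of_mem hz))
      fun z hz => hne z (Multiset.mem_cons_of_mem hz)
    have ha1 := exists_pt_eq (h1 a (Multiset.mem_cons_self a r))
    have ha := hasDerivAt_norm_sq (Complex.arg a) θ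
      (by rw [ha1]; exact hne a (Multiset.mem_cons_self a r))
    rw [ha1] at ha
    simp only [Multiset.map_cons, Multiset.prod_cons, Multiset.sum_cons]
    exact (ha.fun_mul hr).congr_deriv (by ring)

theorem norm_sq_eval_eq_prod {R : ℂ[X]} (hR : R.Monic) (z : ℂ) :
    ‖R.eval z‖ ^ 2 = (R.roots.map fun w => ‖z - w‖ ^ 2).prod := by
  rw [eval_eq_prod_roots hR]
  generalize R.roots = r
  induction r using Multiset.induction_on with
  | empty => simp
  | cons a r ih => simp only [Multiset.map_cons, Multiset.prod_cons, norm_mul, mul_pow, ih]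

end Trigonometry

/-! ### The real kernel and its logarithmic derivative -/

section Kernel

/-- Up to a constant, the function `P(z) conj (z R(z))` of the angle, where
`P = (X - e^{iφ}) (X - e^{iθ₀}) R`. -/
def angleKernel (θ₀ φ : ℝ) (R : ℂ[X]) (θ : ℝ) : ℝ :=
  Real.sin ((θ - φ) / 2) * Real.sin ((θ - θ₀) / 2) * ‖R.eval (pt θ)‖ ^ 2

/-- The quotient of `angleKernel` and `s`. -/
def angleWeight (θ₀ φ : ℝ) (R : ℂ[X]) (θ : ℝ) : ℝ :=
  2 * Real.sin ((θ - φ) / 2) ^ 2 * Real.sin ((θ - θ₀) / 2) ^ 2 * ‖R.eval (pt θ)‖ ^ 2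
    / Real.sin ((φ - θ₀) / 2)

variable {θ₀ φ : ℝ} {P R : ℂ[X]}

/-- The half-angle phases of the two linear factors multiply to `pt θ` times a constant, and the
conjugate of `X` removes `pt θ`. Only a constant phase is left, so the integrals become real. -/
theorem eval_mul_conj_eq (hR : P = (X - C (pt φ)) * (X - C (pt θ₀)) * R) (θ : ℝ) :
    P.eval (pt θ) * conj ((X * R).eval (pt θ))
      = -4 * pt ((φ + θ₀) / 2) * (angleKernel θ₀ φ R θ : ℂ) := by
  have h1 : pt ((θ + φ) / 2) * pt ((θ + θ₀) / 2) = pt θ * pt ((φ + θ₀) / 2) := by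
    rw [← pt_add, ← pt_add]; congr 1; ring
  have h2 := Complex.mul_conj' (R.eval (pt θ))
  rw [hR, angleKernel]
  simp only [eval_mul, eval_sub, eval_X, eval_C, map_mul, pt_sub_pt]
  push_cast
  rw [← h2]
  linear_combination (4 * Complex.I ^ 2 * Complex.sin ((θ - φ) / 2) * Complex.sin ((θ - θ₀) / 2)
      * eval (pt θ) R * conj (eval (pt θ) R)) * (conj (pt θ) * h1
        + pt ((φ + θ₀) / 2) * pt_mul_conj θ)
    + 4 * pt ((φ + θ₀) / 2) * Complex.sin ((θ - φ) / 2) * Complex.sin ((θ - θ₀) / 2)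
      * eval (pt θ) R * conj (eval (pt θ) R) * Complex.I_sq

theorem differentiable_angleKernel (θ₀ φ : ℝ) (R : ℂ[X]) :
    Differentiable ℝ (angleKernel θ₀ φ R) := by
  have h1 : Differentiable ℝ fun θ => ‖R.eval (pt θ)‖ ^ 2 :=
    (IsDifferentiableFamily.differentiable_eval_pt R).norm_sq ℝ
  unfold angleKernel
  fun_prop

theorem bounded_angleKernel (θ₀ φ : ℝ) (R : ℂ[X]) : ∃ K, ∀ θ, ‖angleKernel θ₀ φ R θ‖ ≤ K := by
  obtain ⟨K, hK⟩ := bounded_comp_pt (g := fun z => ((‖R.eval z‖ ^ 2 : ℝ) : ℂ)) (by fun_prop)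
  refine ⟨K, fun θ => ?_⟩
  have h1 : ‖R.eval (pt θ)‖ ^ 2 ≤ K := by simpa using hK θ
  rw [angleKernel, norm_mul, norm_mul, Real.norm_eq_abs, Real.norm_eq_abs, Real.norm_eq_abs,
    abs_of_nonneg (by positivity : 0 ≤ ‖R.eval (pt θ)‖ ^ 2)]
  refine le_trans ?_ h1
  refine mul_le_of_le_one_left (by positivity) ?_
  exact mul_le_one₀ (Real.abs_sin_le_one _) (abs_nonneg _) (Real.abs_sin_le_one _)

theorem angleKernel_eq (h : Real.sin ((φ - θ₀) / 2) ≠ 0) (θ : ℝ) :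
    angleKernel θ₀ φ R θ = angleWeight θ₀ φ R θ * s θ₀ φ θ := by
  have h1 : Real.sin ((φ - θ) / 2) = -Real.sin ((θ - φ) / 2) := by
    rw [← Real.sin_neg]; congr 1; ring
  have h2 : Real.sin ((θ₀ - θ) / 2) = -Real.sin ((θ - θ₀) / 2) := by
    rw [← Real.sin_neg]; congr 1; ring
  rw [angleKernel, angleWeight, s, h1, h2]
  -- At the poles of `s` the kernel and the weight both vanish, so the identity holds there as well.
  by_cases ha : Real.sin ((θ - φ) / 2) = 0
  · simp [ha]
  by_cases hb : Real.sin ((θ - θ₀) / 2) = 0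
  · simp [hb]
  field_simp

theorem angleWeight_nonneg (h : 0 < Real.sin ((φ - θ₀) / 2)) (θ : ℝ) :
    0 ≤ angleWeight θ₀ φ R θ := by
  unfold angleWeight; positivity

theorem angleWeight_pos (h : 0 < Real.sin ((φ - θ₀) / 2))
    (hR : P = (X - C (pt φ)) * (X - C (pt θ₀)) * R) {θ : ℝ} (hθ : P.eval (pt θ) ≠ 0) :
    0 < angleWeight θ₀ φ R θ := by
  rw [hR] at hθ
  simp only [eval_mul, eval_sub, eval_X, eval_C, mul_ne_zero_iff, sub_ne_zero] at hθ
  have h1 := sin_ne_zero_of_pt_ne hθ.1.1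
  have h2 := sin_ne_zero_of_pt_ne hθ.1.2
  have h3 := hθ.2
  unfold angleWeight; positivity

theorem S_eq (hP : P ≠ 0) (hR : P = (X - C (pt φ)) * (X - C (pt θ₀)) * R)
    (hφ : R.eval (pt φ) ≠ 0) (h₀ : R.eval (pt θ₀) ≠ 0) {θ : ℝ} (hθφ : pt θ ≠ pt φ)
    (hθ₀ : pt θ ≠ pt θ₀) :
    S P θ₀ φ θ = 1 / 2 * Real.cot ((φ - θ) / 2) + 1 / 2 * Real.cot ((θ₀ - θ) / 2)
      + (R.roots.map fun z => Real.cot ((Complex.arg z - θ) / 2)).sum := by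
  have hroots : P.roots = {pt φ} + {pt θ₀} + R.roots := by
    rw [hR, roots_mul (hR ▸ hP), roots_mul (mul_ne_zero (X_sub_C_ne_zero _) (X_sub_C_ne_zero _)),
      roots_X_sub_C, roots_X_sub_C]
  have ha : ∀ a, pt θ ≠ pt a →
      Real.cot ((Complex.arg (pt a) - θ) / 2) = Real.cot ((a - θ) / 2) := by
    intro a hne
    have := exists_pt_eq (norm_pt a)
    exact cot_half_eq this (by rwa [this])
  rw [S, hroots]
  simp only [Multiset.map_add, Multiset.sum_add, Multiset.map_singleton, Multiset.sum_singleton,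
    true_or, or_true, if_true, ha φ hθφ, ha θ₀ hθ₀]
  congr 2
  refine Multiset.map_congr rfl fun z hz => ?_
  have hz0 : R.eval z = 0 := isRoot_of_mem_roots hz
  rw [if_neg, one_mul]
  rintro (rfl | rfl)
  exacts [h₀ hz0, hφ hz0]

/-- The zeros `pt φ`, `pt θ₀` enter the kernel through a sine to the first power, the others through
a squared modulus; this is the origin of the weights `1 / 2` and `1` in `S`. -/
theorem hasDerivAt_angleKernel (hP : P ≠ 0) (hRm : R.Monic)
    (hR : P = (X - C (pt φ)) * (X - C (pt θ₀)) * R) (hφ : R.eval (pt φ) ≠ 0)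
    (h₀ : R.eval (pt θ₀) ≠ 0) (hroots : ∀ z, R.eval z = 0 → ‖z‖ = 1) {θ : ℝ}
    (hθ : P.eval (pt θ) ≠ 0) :
    HasDerivAt (angleKernel θ₀ φ R) (-S P θ₀ φ θ * angleKernel θ₀ φ R θ) θ := by
  have hθ' := hθ
  rw [hR] at hθ'
  simp only [eval_mul, eval_sub, eval_X, eval_C, mul_ne_zero_iff, sub_ne_zero] at hθ'
  obtain ⟨⟨h1, h2⟩, h3⟩ := hθ'
  rw [S_eq hP hR hφ h₀ h1 h2]
  have h4 := hasDerivAt_prod_norm_sq R.roots θ (fun z hz => hroots z (isRoot_of_mem_roots hz))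
    (fun z hz h => h3 (by rw [h]; exact isRoot_of_mem_roots hz))
  simp_rw [← norm_sq_eval_eq_prod hRm] at h4
  refine (((hasDerivAt_sin_half φ θ (sin_ne_zero_of_pt_ne h1)).fun_mul
    (hasDerivAt_sin_half θ₀ θ (sin_ne_zero_of_pt_ne h2))).fun_mul h4).congr_deriv ?_
  rw [angleKernel]
  ring

end Kernel

/-! ### The velocity formula -/

section Velocity

variable {J : Set ℝ} {θ₀ : ℝ} {μ : Measure ℝ} {ω : ℝ → ℝ → ℝ} {N : ℕ}
  {γ Ω : Fin (N + 1) → ℝ → ℝ} {n : ℕ} {b : ℝ → ℂ} {P : ℝ → ℂ[X]} {t : ℝ} {R : ℂ[X]}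

/-- Both sides are the derivative of the same integral, so no termwise computation is needed. -/
theorem IsDifferentiableFamily.derivIntegral_const_mul_ofReal
    (h : IsDifferentiableFamily J θ₀ μ ω γ Ω) (ht : t ∈ J) {g : ℝ → ℝ} (hg : Differentiable ℝ g)
    {K : ℝ} (hK : ∀ θ, ‖g θ‖ ≤ K) (c : ℂ) :
    derivIntegral θ₀ μ ω γ Ω t (fun θ => c * (g θ : ℂ))
      = c * (derivIntegral θ₀ μ ω γ Ω t g : ℝ) := by
  have h1 : HasDerivAt (fun τ => ∫ θ, c * (g θ : ℂ) ∂(mixedMeasure θ₀ μ ω γ Ω τ)) _ t :=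
    h.hasDerivAt_integral ht (K := ‖c‖ * K)
      (fun θ => ((hg θ).hasDerivAt.ofReal_comp.const_mul c).differentiableAt) fun θ => by
        rw [norm_mul, Complex.norm_real]
        exact mul_le_mul_of_nonneg_left (hK θ) (norm_nonneg c)
  refine h1.unique ?_
  simp_rw [integral_const_mul, integral_complex_ofReal]
  exact (h.hasDerivAt_integral ht hg hK).ofReal_comp.const_mul c

/-- A density that vanishes has vanishing derivative, so that `f` times the density is its
derivative. -/
theorem IsDifferentiableFamily.f_mul_ae (h : IsDifferentiableFamily J θ₀ μ ω γ Ω) (ht : t ∈ J) :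
    ∀ᵐ θ ∂(μ.restrict (Ico θ₀ (θ₀ + 2 * Real.pi))),
      f ω θ t * ω θ t = deriv (fun τ => ω θ τ) t := by
  filter_upwards [h.nonneg] with θ hθ
  by_cases h0 : ω θ t = 0
  -- A nonnegative density that vanishes at time `t` has a local minimum in time there.
  · have hmin : IsLocalMin (fun τ => ω θ τ) t := by
      filter_upwards [h.isOpen.mem_nhds ht] with τ hτ
      rw [h0]; exact hθ τ hτ
    rw [hmin.deriv_eq_zero, h0, mul_zero]
  · rw [f]; field_simp

/-- The derivative of the measure applied to the kernel, in terms of `W` and `W_j`. -/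
theorem IsDifferentiableFamily.derivIntegral_angleKernel
    (h : IsDifferentiableFamily J θ₀ μ ω γ Ω) (ht : t ∈ J) {φ : ℝ}
    (hsin : Real.sin ((φ - θ₀) / 2) ≠ 0)
    (hG0 : ∫ θ, angleKernel θ₀ φ R θ ∂(mixedMeasure θ₀ μ ω γ Ω t) = 0)
    (hG' : ∀ j, deriv (angleKernel θ₀ φ R) (Ω j t)
      = -S (P t) θ₀ φ (Ω j t) * angleKernel θ₀ φ R (Ω j t)) :
    Integrable (fun θ => angleWeight θ₀ φ R θ * W θ₀ ω φ θ t * ω θ t)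
        (μ.restrict (Ico θ₀ (θ₀ + 2 * Real.pi))) ∧
      derivIntegral θ₀ μ ω γ Ω t (angleKernel θ₀ φ R)
        = ∫ θ in Ico θ₀ (θ₀ + 2 * Real.pi), angleWeight θ₀ φ R θ * W θ₀ ω φ θ t * ω θ t ∂μ
          + ∑ j, angleWeight θ₀ φ R (Ω j t) * Wj θ₀ ω (γ j) (Ω j) (P t) φ t := by
  have hgd := differentiable_angleKernel θ₀ φ R
  obtain ⟨K, hK⟩ := bounded_angleKernel θ₀ φ R
  have hbdd : ∀ {w : ℝ → ℝ}, Integrable w (μ.restrict (Ico θ₀ (θ₀ + 2 * Real.pi))) →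
      Integrable (fun θ => w θ • angleKernel θ₀ φ R θ)
        (μ.restrict (Ico θ₀ (θ₀ + 2 * Real.pi))) := fun hw =>
    hw.smul_bdd K hgd.continuous.aestronglyMeasurable (Eventually.of_forall hK)
  have h1 := hbdd (h.integrable_deriv ht)
  have h2 := (hbdd (h.integrable t ht)).const_mul (f ω φ t)
  have hae : (fun θ => deriv (fun τ => ω θ τ) t • angleKernel θ₀ φ R θ
      - f ω φ t * (ω θ t • angleKernel θ₀ φ R θ))
      =ᵐ[μ.restrict (Ico θ₀ (θ₀ + 2 * Real.pi))]
      fun θ => angleWeight θ₀ φ R θ * W θ₀ ω φ θ t * ω θ t := by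
    filter_upwards [h.f_mul_ae ht] with θ hθ
    rw [← hθ, angleKernel_eq hsin, W]
    simp only [smul_eq_mul]
    ring
  refine ⟨(h1.sub h2).congr hae, ?_⟩
  -- The kernel has total integral zero, so `f(φ)` times that integral may be subtracted; this
  -- creates the `f(φ)` terms in `W` and `Wj`.
  rw [h.integral_eq ht hgd.continuous hK] at hG0
  rw [← integral_congr_ae hae, integral_sub h1 h2, integral_const_mul, derivIntegral]
  have h3 : ∑ j, angleWeight θ₀ φ R (Ω j t) * Wj θ₀ ω (γ j) (Ω j) (P t) φ t
      = ∑ j, (γ j t • deriv (Ω j) t • deriv (angleKernel θ₀ φ R) (Ω j t)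
          + deriv (γ j) t • angleKernel θ₀ φ R (Ω j t))
        - f ω φ t * ∑ j, γ j t • angleKernel θ₀ φ R (Ω j t) := by
    rw [Finset.mul_sum, ← Finset.sum_sub_distrib]
    refine Finset.sum_congr rfl fun j _ => ?_
    rw [hG' j, angleKernel_eq hsin, Wj]
    simp only [smul_eq_mul]
    ring
  rw [h3]
  linear_combination (f ω φ t) * hG0

/-- The velocity of a zero in the presence of the fixed zero `e^{iθ₀}`. -/
theorem IsDifferentiableFamily.hasDerivAt_branch (h : IsDifferentiableFamily J θ₀ μ ω γ Ω)
    (hP : ∀ t ∈ J, IsPOPUC (mixedMeasure θ₀ μ ω γ Ω t) n (b t) (P t)) (ht : t ∈ J)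
    (hc : ∀ i, DifferentiableAt ℝ (fun τ => (P τ).coeff i) t) {ζ : ℝ → ℂ}
    (hζ : DifferentiableAt ℝ ζ t) (h0 : ∀ᶠ τ in 𝓝 t, (P τ).eval (ζ τ) = 0)
    (hw : ∀ᶠ τ in 𝓝 t, (P τ).eval (pt θ₀) = 0) {φ : ℝ} (hφ : ζ t = pt φ)
    (hsin : 0 < Real.sin ((φ - θ₀) / 2)) (hΩ : ∀ j, (P t).eval (pt (Ω j t)) ≠ 0) :
    ∃ p : ℝ → ℝ, (∀ θ, 0 ≤ p θ) ∧ (∀ θ, (P t).eval (pt θ) ≠ 0 → 0 < p θ) ∧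
      Integrable (fun θ => p θ * W θ₀ ω φ θ t * ω θ t)
        (μ.restrict (Ico θ₀ (θ₀ + 2 * Real.pi))) ∧
      ∃ κ : ℝ, 0 < κ ∧ HasDerivAt ζ (Complex.I * ζ t * (κ *
        (∫ θ in Ico θ₀ (θ₀ + 2 * Real.pi), p θ * W θ₀ ω φ θ t * ω θ t ∂μ
          + ∑ j, p (Ω j t) * Wj θ₀ ω (γ j) (Ω j) (P t) φ t : ℝ))) t := by
  have := h.isFiniteMeasure ht
  have hPt := hP t ht
  have hsupp := h.support t ht
  have hne : ζ t ≠ pt θ₀ := by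
    intro he
    rw [hφ, ← sub_eq_zero, pt_sub_pt, mul_eq_zero] at he
    have h1 : (Real.sin ((φ - θ₀) / 2) : ℂ) ≠ 0 := Complex.ofReal_ne_zero.2 hsin.ne'
    exact he.elim (pt_ne_zero _) (mul_ne_zero (by simp) h1)
  have hz : (P t).eval (pt φ) = 0 := hφ ▸ h0.self_of_nhds
  obtain ⟨R, hR⟩ : (X - C (pt φ)) * (X - C (pt θ₀)) ∣ P t :=
    IsCoprime.mul_dvd (isCoprime_X_sub_C_of_isUnit_sub (sub_ne_zero.2 (hφ ▸ hne)).isUnit)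
      (dvd_iff_isRoot.2 hz) (dvd_iff_isRoot.2 hw.self_of_nhds)
  have hRm : R.Monic := by
    refine Monic.of_mul_monic_left ((monic_X_sub_C (pt φ)).mul (monic_X_sub_C (pt θ₀))) ?_
    rw [← hR]; exact hPt.monic
  have hRroot : ∀ z, R.eval z = 0 → (P t).eval z = 0 := fun z hz => by
    rw [hR, eval_mul, hz, mul_zero]
  have hRφ : R.eval (pt φ) ≠ 0 := fun h1 => by
    have := hPt.derivative_ne_zero hsupp hz
    rw [hR] at this
    simp [derivative_mul, h1] at this
  have hR₀ : R.eval (pt θ₀) ≠ 0 := fun h1 => by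
    have := hPt.derivative_ne_zero hsupp hw.self_of_nhds
    rw [hR] at this
    simp [derivative_mul, h1] at this
  have hgd := differentiable_angleKernel θ₀ φ R
  obtain ⟨K, hK⟩ := bounded_angleKernel θ₀ φ R
  have hc0 : -4 * pt ((φ + θ₀) / 2) ≠ 0 := mul_ne_zero (by norm_num) (pt_ne_zero _)
  have hRlt : R.degree < n := by
    have h1 := hPt.natDegree
    rw [hR, natDegree_mul (mul_ne_zero (X_sub_C_ne_zero _) (X_sub_C_ne_zero _)) hRm.ne_zero,
      natDegree_mul (X_sub_C_ne_zero _) (X_sub_C_ne_zero _), natDegree_X_sub_C,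
      natDegree_X_sub_C] at h1
    rw [degree_eq_natDegree hRm.ne_zero]
    exact_mod_cast (by omega : R.natDegree < n)
  have horth := hPt.ip_eq_zero hRlt
  have hG0 : ∫ θ, angleKernel θ₀ φ R θ ∂(mixedMeasure θ₀ μ ω γ Ω t) = 0 := by
    have h1 := horth
    rw [ip] at h1
    simp_rw [eval_mul_conj_eq hR, integral_const_mul, integral_complex_ofReal] at h1
    exact_mod_cast (mul_eq_zero.1 h1).resolve_left hc0
  obtain ⟨hint, hV⟩ := h.derivIntegral_angleKernel ht hsin.ne' hG0 fun j =>
    (hasDerivAt_angleKernel hPt.monic.ne_zero hRm hR hRφ hR₀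
      (fun z hz => hPt.norm_eq_one hsupp (hRroot z hz)) (hΩ j)).deriv
  have hne0 : (X - C (pt θ₀)) * R ≠ 0 := mul_ne_zero (X_sub_C_ne_zero _) hRm.ne_zero
  have hL := integral_norm_sq_pos hsupp hne0
  have hLip := ip_self (mixedMeasure θ₀ μ ω γ Ω t) ((X - C (pt θ₀)) * R)
  set L := ∫ θ, ‖((X - C (pt θ₀)) * R).eval (pt θ)‖ ^ 2 ∂(mixedMeasure θ₀ μ ω γ Ω t)
  -- The `8` is the product of `-4` from the kernel and `-2` from `1 - conj w * ζ`, whose sine also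
  -- appears; `L` is the norm from `ip_fixed_factor`, and the phases combine to `I * ζ`.
  refine ⟨angleWeight θ₀ φ R, angleWeight_nonneg hsin, fun θ hθ => angleWeight_pos hsin hR hθ,
    hint, 8 * Real.sin ((φ - θ₀) / 2) / L, by positivity, ?_⟩
  rw [← hV]
  refine hζ.hasDerivAt.congr_deriv ?_
  have h1 := h.derivIntegral_eq hP ht hc hζ.hasDerivAt h0 hw hne (hφ.symm ▸ hR)
  simp_rw [eval_mul_conj_eq hR] at h1
  rw [h.derivIntegral_const_mul_ofReal ht hgd hK] at h1
  have h2 := ip_fixed_factor (hR ▸ horth)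
  rw [hLip] at h2
  have h3 : 1 - conj (pt θ₀) * pt φ
      = -(pt ((φ - θ₀) / 2) * (2 * Complex.I * Real.sin ((φ - θ₀) / 2))) := by
    have e1 := pt_sub_pt φ θ₀
    have e2 : pt ((φ + θ₀) / 2) = pt θ₀ * pt ((φ - θ₀) / 2) := by
      rw [← pt_add]; congr 1; ring
    rw [e2] at e1
    linear_combination (-conj (pt θ₀)) * e1 - (1 + pt ((φ - θ₀) / 2) * (2 * Complex.I
      * Real.sin ((φ - θ₀) / 2))) * pt_mul_conj θ₀
  have h4 : pt ((φ + θ₀) / 2) * pt ((φ - θ₀) / 2) = pt φ := by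
    rw [← pt_add]; congr 1; ring
  have hLc : (L : ℂ) ≠ 0 := by exact_mod_cast hL.ne'
  rw [hφ]
  push_cast
  field_simp
  rw [h3] at h2
  push_cast at h2
  rw [← h4]
  linear_combination (-deriv ζ t) * h2 + (pt ((φ - θ₀) / 2) * (2 * Complex.I
    * Complex.sin ((φ - θ₀) / 2))) * h1

end Velocity

/-! ### Sign of the velocity -/

section Sign

variable {θ₀ φ θ t : ℝ} {ω : ℝ → ℝ → ℝ}

theorem s_neg (hφ : φ < θ₀ + 2 * Real.pi) (hθ : θ₀ < θ) (h : θ < φ) : s θ₀ φ θ < 0 := by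
  have h1 : 0 < Real.sin ((φ - θ₀) / 2) :=
    Real.sin_pos_of_pos_of_lt_pi (by linarith) (by linarith)
  have h2 : 0 < Real.sin ((φ - θ) / 2) :=
    Real.sin_pos_of_pos_of_lt_pi (by linarith) (by linarith)
  have h3 : Real.sin ((θ₀ - θ) / 2) < 0 :=
    Real.sin_neg_of_neg_of_neg_pi_lt (by linarith) (by linarith)
  exact div_neg_of_pos_of_neg h1 (mul_neg_of_pos_of_neg (by positivity) h3)

theorem s_pos (hφ : θ₀ < φ) (hθ : θ < θ₀ + 2 * Real.pi) (h : φ < θ) : 0 < s θ₀ φ θ := by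
  have h1 : 0 < Real.sin ((φ - θ₀) / 2) :=
    Real.sin_pos_of_pos_of_lt_pi (by linarith) (by linarith)
  have h2 : Real.sin ((φ - θ) / 2) < 0 :=
    Real.sin_neg_of_neg_of_neg_pi_lt (by linarith) (by linarith)
  have h3 : Real.sin ((θ₀ - θ) / 2) < 0 :=
    Real.sin_neg_of_neg_of_neg_pi_lt (by linarith) (by linarith)
  exact div_pos h1 (mul_pos_of_neg_of_neg (by linarith) h3)

theorem s_fixed (θ₀ φ : ℝ) : s θ₀ φ θ₀ = 0 := by simp [s]

/-- Inside the interval, `s` is negative before `φ` and positive after it, matching the sign of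
`f(θ) - f(φ)`. At `θ = θ₀` division by zero makes `s` zero, so monotonicity on the open interval is
enough. -/
theorem W_nonneg (hφ : φ ∈ Ioo θ₀ (θ₀ + 2 * Real.pi))
    (hf : MonotoneOn (fun θ => f ω θ t) (Ioo θ₀ (θ₀ + 2 * Real.pi)))
    (hθ : θ ∈ Ico θ₀ (θ₀ + 2 * Real.pi)) : 0 ≤ W θ₀ ω φ θ t := by
  rcases hθ.1.eq_or_lt with rfl | h0
  · rw [W, s_fixed, zero_mul]
  rcases lt_trichotomy θ φ with h | rfl | h
  · exact mul_nonneg_of_nonpos_of_nonpos (s_neg hφ.2 h0 h).le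
      (sub_nonpos.2 (hf ⟨h0, hθ.2⟩ hφ h.le))
  · rw [W, sub_self, mul_zero]
  · exact mul_nonneg (s_pos hφ.1 hθ.2 h).le (sub_nonneg.2 (hf hφ ⟨h0, hθ.2⟩ h.le))

theorem W_pos (hφ : φ ∈ Ioo θ₀ (θ₀ + 2 * Real.pi))
    (hf : StrictMonoOn (fun θ => f ω θ t) (Ioo θ₀ (θ₀ + 2 * Real.pi)))
    (hθ : θ ∈ Ioo θ₀ (θ₀ + 2 * Real.pi)) (hne : θ ≠ φ) : 0 < W θ₀ ω φ θ t := by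
  rcases lt_or_gt_of_ne hne with h | h
  · exact mul_pos_of_neg_of_neg (s_neg hφ.2 hθ.1 h) (sub_neg.2 (hf hθ hφ h))
  · exact mul_pos (s_pos hφ.1 hθ.2 h) (sub_pos.2 (hf hφ hθ h))

variable {J : Set ℝ} {μ : Measure ℝ} {N : ℕ} {γ Ω : Fin (N + 1) → ℝ → ℝ}

/-- The part of the measure with a density is not carried by finitely many points. -/
theorem IsDifferentiableFamily.density_not_ae_zero (h : IsDifferentiableFamily J θ₀ μ ω γ Ω)
    (ht : t ∈ J) {F : Set ℂ} (hF : F.Finite) :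
    ¬ ∀ᵐ θ ∂(μ.restrict (Ico θ₀ (θ₀ + 2 * Real.pi))), pt θ ∉ F → ω θ t = 0 := by
  intro hae
  -- Enlarging `F` by the locations of the masses removes the Dirac part from the measure of the
  -- complement.
  let F' : Set ℂ := F ∪ range fun j => pt (Ω j t)
  have hF' : F'.Finite := hF.union (finite_range _)
  have hmeas : MeasurableSet {θ | pt θ ∉ F'} :=
    (hF'.isClosed.isOpen_compl.preimage continuous_pt).measurableSet
  refine h.support t ht F' hF' ?_
  rw [mixedMeasure, Measure.add_apply, Measure.finsetSum_apply]
  have h1 : ∑ j, (ENNReal.ofReal (γ j t) • Measure.dirac (Ω j t)) {θ | pt θ ∉ F'} = 0 := by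
    refine Finset.sum_eq_zero fun j _ => ?_
    rw [Measure.smul_apply, Measure.dirac_apply' _ hmeas, indicator_of_notMem, smul_zero]
    exact fun h => h (Or.inr ⟨j, rfl⟩)
  rw [h1, add_zero, withDensity_apply _ hmeas, ← lintegral_indicator hmeas]
  refine (lintegral_congr_ae ?_).trans lintegral_zero
  filter_upwards [hae] with θ hθ
  by_cases hm : θ ∈ {θ | pt θ ∉ F'}
  · rw [indicator_of_mem hm, hθ fun h => hm (Or.inl h), ENNReal.ofReal_zero]
  · rw [indicator_of_notMem hm]

/-- The velocity is positive. -/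
theorem IsDifferentiableFamily.velocity_pos (h : IsDifferentiableFamily J θ₀ μ ω γ Ω)
    (ht : t ∈ J) {P : ℂ[X]} (hP0 : P ≠ 0) (hfix : P.eval (pt θ₀) = 0) (hzero : P.eval (pt φ) = 0)
    (hφ : φ ∈ Ioo θ₀ (θ₀ + 2 * Real.pi)) (hΩ : ∀ j, P.eval (pt (Ω j t)) ≠ 0) {p : ℝ → ℝ}
    (hp : ∀ θ, 0 ≤ p θ) (hp' : ∀ θ, P.eval (pt θ) ≠ 0 → 0 < p θ)
    (hint : Integrable (fun θ => p θ * W θ₀ ω φ θ t * ω θ t)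
      (μ.restrict (Ico θ₀ (θ₀ + 2 * Real.pi))))
    (hf : MonotoneOn (fun θ => f ω θ t) (Ioo θ₀ (θ₀ + 2 * Real.pi))) {w : Fin (N + 1) → ℝ}
    (hw : ∀ j, 0 ≤ w j)
    (hpos : StrictMonoOn (fun θ => f ω θ t) (Ioo θ₀ (θ₀ + 2 * Real.pi)) ∨ ∃ j, 0 < w j) :
    0 < ∫ θ in Ico θ₀ (θ₀ + 2 * Real.pi), p θ * W θ₀ ω φ θ t * ω θ t ∂μ
      + ∑ j, p (Ω j t) * w j := by
  have hnonneg : 0 ≤ᵐ[μ.restrict (Ico θ₀ (θ₀ + 2 * Real.pi))]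
      fun θ => p θ * W θ₀ ω φ θ t * ω θ t := by
    filter_upwards [h.nonneg, ae_restrict_mem measurableSet_Ico] with θ hθ hmem
    exact mul_nonneg (mul_nonneg (hp θ) (W_nonneg hφ hf hmem)) (hθ t ht)
  have hI := integral_nonneg_of_ae hnonneg
  have hS : 0 ≤ ∑ j, p (Ω j t) * w j := Finset.sum_nonneg fun j _ => mul_nonneg (hp _) (hw j)
  rcases hpos with hf' | ⟨j, hj⟩
  · refine add_pos_of_pos_of_nonneg (hI.lt_of_ne' fun h0 => ?_) hS
    rw [integral_eq_zero_iff_of_nonneg_ae hnonneg hint] at h0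
    -- Off the roots of `P` both `p` and `W` are positive, so a zero integral would force the
    -- density to vanish there.
    refine h.density_not_ae_zero ht (F := (P.roots.toFinset : Set ℂ)) (Finset.finite_toSet _) ?_
    filter_upwards [h0, ae_restrict_mem measurableSet_Ico] with θ hθ hmem hroot
    have hne : P.eval (pt θ) ≠ 0 := by simpa [hP0] using hroot
    have h1 : θ ≠ θ₀ := by rintro rfl; exact hne hfix
    have h2 : θ ≠ φ := by rintro rfl; exact hne hzero
    have h3 := W_pos hφ hf' ⟨hmem.1.lt_of_ne' h1, hmem.2⟩ h2
    exact (mul_eq_zero.1 hθ).resolve_left (mul_pos (hp' θ hne) h3).ne'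
  · exact add_pos_of_nonneg_of_pos hI (Finset.sum_pos' (fun j _ => mul_nonneg (hp _) (hw j))
      ⟨j, Finset.mem_univ j, mul_pos (hp' _ (hΩ j)) hj⟩)

end Sign

/-- The angle of a differentiable motion on the circle is differentiable where it stays away from
the ends of the interval of angles. -/
theorem hasDerivAt_angle {θ₀ t v : ℝ} {ζ : ℝ → ℂ} {φ : ℝ → ℝ}
    (hφ : ∀ᶠ τ in 𝓝 t, φ τ ∈ Ioo θ₀ (θ₀ + 2 * Real.pi) ∧ ζ τ = pt (φ τ))
    (hζ : HasDerivAt ζ (Complex.I * ζ t * v) t) : HasDerivAt φ v t := by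
  -- Rotation by `-θ₀ - π` carries the interval of angles to `(-π, π)`, where the principal
  -- logarithm recovers the angle.
  have hlog : ∀ x ∈ Ioo θ₀ (θ₀ + 2 * Real.pi), Complex.log (pt x * pt (-θ₀ - Real.pi))
      = ((x - θ₀ - Real.pi : ℝ) : ℂ) * Complex.I := by
    intro x hx
    rw [← pt_add, pt, Complex.log_exp]
    · congr 2; ring
    · simp; linarith [hx.1]
    · simp; linarith [hx.2]
  have hslit : pt (φ t) * pt (-θ₀ - Real.pi) ∈ Complex.slitPlane := by
    have hx := hφ.self_of_nhds.1
    rw [Complex.mem_slitPlane_iff_arg]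
    refine ⟨?_, mul_ne_zero (pt_ne_zero _) (pt_ne_zero _)⟩
    rw [← Complex.log_im, hlog _ hx]
    simp only [Complex.mul_I_im, Complex.ofReal_re]
    intro h; linarith [hx.2]
  have h1 := hζ.mul_const (pt (-θ₀ - Real.pi))
  have h2 := h1.clog_real (by rw [hφ.self_of_nhds.2]; exact hslit)
  have h3 := (Complex.imCLM.hasFDerivAt.comp_hasDerivAt t h2).const_add (θ₀ + Real.pi)
  have h4 : Complex.imCLM (Complex.I * ζ t * v * pt (-θ₀ - Real.pi)
      / (ζ t * pt (-θ₀ - Real.pi))) = v := by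
    have h5 : ζ t ≠ 0 := by rw [hφ.self_of_nhds.2]; exact pt_ne_zero _
    have h6 := pt_ne_zero (-θ₀ - Real.pi)
    rw [show Complex.I * ζ t * v * pt (-θ₀ - Real.pi) / (ζ t * pt (-θ₀ - Real.pi))
      = v * Complex.I by field_simp]
    simp
  refine (h3.congr_deriv h4).congr_of_eventuallyEq ?_
  filter_upwards [hφ] with τ hτ
  simp only [Function.comp, hτ.2, hlog _ hτ.1, Complex.imCLM_apply, Complex.mul_I_im,
    Complex.ofReal_re]
  ring

end POPUC

end

/-! ### Assembly of the theorem -/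

theorem theorem2p3
    (J : Set ℝ) (hJo : IsOpen J) (hJc : J.OrdConnected) (t₀ : ℝ) (ht₀ : t₀ ∈ J)
    (θ₀ : ℝ) (μ : Measure ℝ) (ω : ℝ → ℝ → ℝ) (N : ℕ) (γ Ω : Fin (N + 1) → ℝ → ℝ)
    -- the measure is finite and nonnegative, with infinite support
    (hωint : ∀ t ∈ J, IntegrableOn (fun θ => ω θ t) (Ico θ₀ (θ₀ + 2 * Real.pi)) μ)
    (hωnonneg : ∀ᵐ θ ∂(μ.restrict (Ico θ₀ (θ₀ + 2 * Real.pi))), ∀ t ∈ J, 0 ≤ ω θ t)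
    (hγnonneg : ∀ j, ∀ t ∈ J, 0 ≤ γ j t)
    (hsupp : ∀ t ∈ J, POPUC.HasInfiniteSupport (POPUC.mixedMeasure θ₀ μ ω γ Ω t))
    -- dependence on the parameter
    (hγdiff : ∀ j, DifferentiableOn ℝ (γ j) J)
    (hΩdiff : ∀ j, DifferentiableOn ℝ (Ω j) J)
    (hωdiff : ∀ᵐ θ ∂(μ.restrict (Ico θ₀ (θ₀ + 2 * Real.pi))), ∀ t ∈ J,
      DifferentiableAt ℝ (fun τ => ω θ τ) t)
    (α : ℝ → ℝ) (hα : IntegrableOn α (Ico θ₀ (θ₀ + 2 * Real.pi)) μ)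
    (hωbound : ∀ᵐ θ ∂(μ.restrict (Ico θ₀ (θ₀ + 2 * Real.pi))), ∀ t ∈ J,
      |deriv (fun τ => ω θ τ) t| ≤ α θ)
    -- the paraorthogonal polynomials and a zero at time `t₀`
    (n : ℕ) (b : ℝ → ℂ) (P : ℝ → Polynomial ℂ)
    (hP : ∀ t ∈ J, POPUC.IsPOPUC (POPUC.mixedMeasure θ₀ μ ω γ Ω t) n (b t) (P t))
    (ζ₀ : ℂ) (hζ₀ : (P t₀).eval ζ₀ = 0) :
    -- local existence and uniqueness of the moving zero
    ((DifferentiableOn ℝ b J ∨ ∀ t ∈ J, (P t).eval (POPUC.pt θ₀) = 0) →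
      ∃ ε > 0, ∃ δ > 0, POPUC.nbhd t₀ ε ⊆ J ∧
        ∃ ζ : ℝ → ℂ, POPUC.IsZeroBranch P t₀ ζ₀ ε δ ζ ∧
          ∀ η : ℝ → ℂ, POPUC.IsZeroBranch P t₀ ζ₀ ε δ η → EqOn η ζ (POPUC.nbhd t₀ ε)) ∧
    -- motion of the zero when `e^{iθ₀}` is a fixed zero
    (∀ ε > 0, ∀ δ > 0, POPUC.nbhd t₀ ε ⊆ J →
      ∀ ζ : ℝ → ℂ, POPUC.IsZeroBranch P t₀ ζ₀ ε δ ζ →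
      (∀ t ∈ POPUC.nbhd t₀ ε, (P t).eval (POPUC.pt θ₀) = 0) → ζ₀ ≠ POPUC.pt θ₀ →
      ∀ φ : ℝ → ℝ,
      (∀ t ∈ POPUC.nbhd t₀ ε,
        φ t ∈ Ico θ₀ (θ₀ + 2 * Real.pi) ∧ ζ t = POPUC.pt (φ t)) →
      -- no point mass is located at a zero, so that the `W_j` are defined
      (∀ t ∈ POPUC.nbhd t₀ ε, ∀ j, (P t).eval (POPUC.pt (Ω j t)) ≠ 0) →
      (((∀ t ∈ POPUC.nbhd t₀ ε,
            MonotoneOn (fun θ => POPUC.f ω θ t) (Ioo θ₀ (θ₀ + 2 * Real.pi)) ∧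
            (∀ j, 0 ≤ POPUC.Wj θ₀ ω (γ j) (Ω j) (P t) (φ t) t) ∧
            (StrictMonoOn (fun θ => POPUC.f ω θ t) (Ioo θ₀ (θ₀ + 2 * Real.pi)) ∨
              ∃ j, 0 < POPUC.Wj θ₀ ω (γ j) (Ω j) (P t) (φ t) t)) →
          ContinuousOn φ (POPUC.nbhd t₀ ε) ∧ StrictMonoOn φ (POPUC.nbhd t₀ ε)) ∧
        ((∀ t ∈ POPUC.nbhd t₀ ε,
            (∀ᵐ θ ∂(μ.restrict (Ico θ₀ (θ₀ + 2 * Real.pi))),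
              POPUC.W θ₀ ω (φ t) θ t = 0) ∧
            ∀ j, POPUC.Wj θ₀ ω (γ j) (Ω j) (P t) (φ t) t = 0) →
          ∀ t ∈ POPUC.nbhd t₀ ε, ζ t = ζ₀))) := by
  have h : POPUC.IsDifferentiableFamily J θ₀ μ ω γ Ω :=
    ⟨hJo, hωint, hωnonneg, hγnonneg, hsupp, hγdiff, hΩdiff, hωdiff, α, hα, hωbound⟩
  refine ⟨fun hb => ?_, ?_⟩
  · refine h.exists_branch hP (fun s hs i => h.differentiableAt_coeff hP hs ?_ i) ht₀ hζ₀
    exact hb.imp (fun hb => hb.differentiableAt (hJo.mem_nhds hs)) fun h0 =>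
      Filter.Eventually.mono (hJo.mem_nhds hs) h0
  intro ε hε δ _ hIJ ζ hζ hfix hne φ hφ hΩ
  have hI : ∀ s ∈ POPUC.nbhd t₀ ε, POPUC.nbhd t₀ ε ∈ nhds s := fun _ hs => POPUC.nbhd_mem_nhds hs
  have hfix' : ∀ s ∈ POPUC.nbhd t₀ ε, ∀ᶠ t in nhds s, (P t).eval (POPUC.pt θ₀) = 0 := fun s hs =>
    Filter.Eventually.mono (hI s hs) hfix
  have hc : ∀ s ∈ POPUC.nbhd t₀ ε, ∀ i, DifferentiableAt ℝ (fun t => (P t).coeff i) s :=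
    fun s hs => h.differentiableAt_coeff hP (hIJ hs) (Or.inr (hfix' s hs))
  have ht₀I := POPUC.mem_nbhd_self (t₀ := t₀) hε
  -- The moving zero never meets `pt θ₀`, so `φ` stays in the open interval and cannot jump across
  -- its ends.
  have hζne := h.branch_ne hP isOpen_Ioo isPreconnected_Ioo hIJ hc hζ.differentiable.continuousOn
    hζ.zero hfix ht₀I (hζ.initial.symm ▸ hne)
  have hφ' : ∀ t ∈ POPUC.nbhd t₀ ε, φ t ∈ Ioo θ₀ (θ₀ + 2 * Real.pi) ∧ ζ t = POPUC.pt (φ t) := by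
    intro t ht
    obtain ⟨h1, h2⟩ := hφ t ht
    refine ⟨⟨h1.1.lt_of_ne fun h0 => hζne t ht ?_, h1.2⟩, h2⟩
    rw [h2, ← h0]
  have hder : ∀ t ∈ POPUC.nbhd t₀ ε, _ := fun t ht =>
    h.hasDerivAt_branch hP (hIJ ht) (hc t ht) (hζ.differentiable.differentiableAt (hI t ht))
      (Filter.Eventually.mono (hI t ht) hζ.zero) (hfix' t ht) (hφ' t ht).2
      (Real.sin_pos_of_pos_of_lt_pi (by linarith [(hφ' t ht).1.1])
        (by linarith [(hφ' t ht).1.2])) (hΩ t ht)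
  constructor
  · intro hmono
    have hvel : ∀ t ∈ POPUC.nbhd t₀ ε, ∃ v, 0 < v ∧ HasDerivAt φ v t := by
      intro t ht
      obtain ⟨p, hp, hp', hint, κ, hκ, hd⟩ := hder t ht
      obtain ⟨hf, hw, hpos⟩ := hmono t ht
      refine ⟨_, mul_pos hκ (h.velocity_pos (hIJ ht) (hP t (hIJ ht)).monic.ne_zero (hfix t ht)
        ((hφ' t ht).2 ▸ hζ.zero t ht) (hφ' t ht).1 (hΩ t ht) hp hp' hint hf hw hpos),
        POPUC.hasDerivAt_angle (Filter.Eventually.mono (hI t ht) hφ') ?_⟩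
      rwa [Complex.ofReal_mul]
    have hcont : ContinuousOn φ (POPUC.nbhd t₀ ε) := fun t ht =>
      (hvel t ht).choose_spec.2.continuousAt.continuousWithinAt
    refine ⟨hcont, strictMonoOn_of_deriv_pos (convex_Ioo _ _) hcont fun t ht => ?_⟩
    obtain ⟨v, hv, hd⟩ := hvel t (interior_subset ht)
    rwa [hd.deriv]
  · intro hW t ht
    rw [← hζ.initial]
    refine isOpen_Ioo.is_const_of_deriv_eq_zero isPreconnected_Ioo hζ.differentiable ?_ ht ht₀I
    intro τ hτ
    obtain ⟨p, -, -, -, κ, -, hd⟩ := hder τ hτ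
    obtain ⟨hWτ, hWj⟩ := hW τ hτ
    have h1 : ∫ θ in Ico θ₀ (θ₀ + 2 * Real.pi), p θ * POPUC.W θ₀ ω (φ τ) θ τ * ω θ τ ∂μ = 0 := by
      refine integral_eq_zero_of_ae ?_
      filter_upwards [hWτ] with θ hθ
      rw [hθ, mul_zero, zero_mul]; rfl
    rw [hd.deriv, h1]
    simp [hWj]
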